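/- **Setting.** All query and host graphs are finite directed multigraphs typed over a type graph $TG$, and a match is a typed graph morphism. For a query subgraph $S$, $\mathcal M_S^{K}$ is the set of matches of $S$ into $K$, and $|m|=|V^S|+|E^S|$ is the size of a match $m$ of $S$. A host graph $H$ is edge-dominated if, for every edge type $e_{TG}$, it has at least as many edges of type $e_{TG}$ as vertices of type $s^{TG}(e_{TG})$, and at least as many as vertices of type $t^{TG}(e_{TG})$. **RETE nets.** A well-formed RETE net $(N,p)$ for a query graph $Q$ without self-loop edges is a binary tree. Its leaves are edge input nodes, each associated with one query edge and its two end vertices. Its inner nodes are join nodes, each associated with the union $Q_l\cup Q_r$ of the query subgraphs of its two dependencies, where $Q_l$ and $Q_r$ share a vertex and both are simpler than (proper subgraphs of) $Q_l\cup Q_r$. The root $p$ is associated with $Q$. A configuration $\mathcal C$ assigns a set of matches to every node. It is consistent if $\mathcal C(n)=\mathcal M_{Q_e}^{H}$ for every edge input $n$ with subgraph $Q_e$, and $\mathcal C(n)=\{m_l\cup m_r \mid m_l\in\mathcal C(n_l),\ m_r\in\mathcal C(n_r),\ m_l|_{Q_l\cap Q_r}=m_r|_{Q_l\cap Q_r}\}$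 for every join $n$ with dependencies $n_l,n_r$. **Localization.** The nodes of the localized net $(N^\Phi,p^\Phi)=localize((N,p))$ hold sets of pairs $(m,\phi)$ of a match and a marking $\phi\in\mathbb N\cup\{\infty\}$. Let $H_p\subseteq H$ be the relevant subgraph. - An edge input for $e:v\to w$ becomes seven nodes: vertex inputs $[v],[w]$ (all matches of the vertex into $H_p$, marked $\infty$); unions $[\cup]_v,[\cup]_w$ over them; a forward navigation node over $[\cup]_v$ and a backward one over $[\cup]_w$ (all matches of $e$ into $H$ whose restriction to $v$, resp. $w$, is a result of the dependency, with its maximal marking); and a union of these two. - A join whose join tree has height $h$ becomes a marking-sensitive join (combining compatible dependency results with the maximum of the markings) and two request projection structures. The structure $RPS_l$ consists of a filter $[\phi>h]$ on the left dependency, a projection to a single vertex $v\in V^{Q_l\cap Q_r}$, and an assignment $[\phi:=h]$. The assignment is added as a dependency of a union $[\cup]_v$ of an arbitrary edge input containing $v$ in the right subtree. $RPS_r$ is the mirror image. - Unions and projections keep the maximal marking of each match. Executing a node replaces its result set by the target result set just described. The sequence $order((N^\Phi,p^\Phi))$ is a reverse topological sorting of the seven nodes if $p$ is an edge input, and if $p$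 is a join it is $$RPS_r,\ order(N^\Phi_l),\ RPS_l,\ order(N^\Phi_r),\ RPS_r,\ order(N^\Phi_l),\ p^\Phi .$$ **Step count.** Nodes are executed incrementally with ideal index structures. A node only handles changes (added matches, increased markings) of its dependencies that occurred since its last execution. The costs are: - being notified of changes by a dependency: $1$ step; nodes whose dependencies have not changed are skipped at no cost, and a vertex input only does work at its first execution; - handling an added dependency match $m$, including the retrieval of adjacent host edges or complementary matches: $|m|$ steps; - constructing a result match $m$, looking it up, and inserting it or increasing its marking: $|m|+1$ steps (also at vertex inputs); - handling an increased marking of a dependency match: $1$ step, plus $1$ step for each associated result match, reached by a stored reference. **Theorem.** There is an absolute constant $K$ such that the following holds. Let $H$ be an edge-dominated graph, $H_p\subseteq H$, $(N,p)$ a well-formed RETE net for a query graph $Q$ without self-loop edges, $\mathcal C$ a consistent configuration for $(N,p)$ and $H$, $(N^\Phi,p^\Phi)=localize((N,p))$ (for any choices made in the construction and any choice of the topological sortings), and $\mathcal C^\Phi_0$ the empty configuration. Then the incremental procedure, run along $order((N^\Phi,p^\Phi))$ from empty result sets, computes $execute(order((N^\Phi,p^\Phi)),N^\Phi,H,H_p,\mathcal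 C^\Phi_0)$ and takes at most $$K\cdot T\cdot(|Q_a|+|Q|)$$ steps, where $T=\sum_{n\in V^N}|\mathcal C(n)|$, $|Q_a|=\frac1T\sum_{n\in V^N}\sum_{m\in\mathcal C(n)}|m|$ is the average size of the matches in $\mathcal C$ (taken as $0$ if $T=0$), and $|Q|=|V^Q|+|E^Q|$. -/

import Mathlib

namespace Rete

/-! ### Graphs, typed graphs, subgraphs -/

/-- A directed multigraph with vertex set `V` and edge set `E`. -/
structure DirGraph (V : Type*) (E : Type*) where
  src : E → V
  tgt : E → V

/-- A graph typed over `TG`: the maps `vtype`, `etype` form a graph morphism into `TG`. -/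
structure TypedGraph {TV TE : Type*} (TG : DirGraph TV TE) (V : Type*) (E : Type*)
    extends DirGraph V E where
  vtype : V → TV
  etype : E → TE
  src_type : ∀ e, vtype (src e) = TG.src (etype e)
  tgt_type : ∀ e, vtype (tgt e) = TG.tgt (etype e)

/-- For every edge type there are at least as many edges of that type as there are vertices of its
source type, and as there are vertices of its target type. -/
def TypedGraph.EdgeDominated {TV TE V E : Type*} {TG : DirGraph TV TE}
    (G : TypedGraph TG V E) : Prop :=
  ∀ eT : TE, max {v : V | G.vtype v = TG.src eT}.ncard {v : V | G.vtype v = TG.tgt eT}.ncard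
    ≤ {e : E | G.etype e = eT}.ncard

structure Subgraph {V E : Type*} (G : DirGraph V E) where
  verts : Set V
  edges : Set E
  src_mem : ∀ e ∈ edges, G.src e ∈ verts
  tgt_mem : ∀ e ∈ edges, G.tgt e ∈ verts

namespace Subgraph

variable {V E : Type*} {G : DirGraph V E}

/-- The whole graph. -/
instance : Top (Subgraph G) := ⟨⟨Set.univ, Set.univ, fun _ _ => trivial, fun _ _ => trivial⟩⟩

/-- The empty subgraph. -/
instance : Bot (Subgraph G) := ⟨⟨∅, ∅, fun _ h => h.elim, fun _ h => h.elim⟩⟩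

/-- Union of subgraphs. -/
instance : Max (Subgraph G) :=
  ⟨fun A B => ⟨A.verts ∪ B.verts, A.edges ∪ B.edges,
    fun e he => he.imp (A.src_mem e) (B.src_mem e),
    fun e he => he.imp (A.tgt_mem e) (B.tgt_mem e)⟩⟩

/-- Intersection of subgraphs. -/
instance : Min (Subgraph G) :=
  ⟨fun A B => ⟨A.verts ∩ B.verts, A.edges ∩ B.edges,
    fun e he => ⟨A.src_mem e he.1, B.src_mem e he.2⟩,
    fun e he => ⟨A.tgt_mem e he.1, B.tgt_mem e he.2⟩⟩⟩

/-- The subgraph consisting of one vertex and no edge. -/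
def ofVertex (G : DirGraph V E) (v : V) : Subgraph G :=
  ⟨{v}, ∅, fun _ h => h.elim, fun _ h => h.elim⟩

/-- The subgraph consisting of one edge and its adjacent vertices. -/
def ofEdge (G : DirGraph V E) (e : E) : Subgraph G :=
  ⟨{G.src e, G.tgt e}, {e}, fun _ h => by cases h; simp, fun _ h => by cases h; simp⟩

end Subgraph

/-! ### Matches -/

/-- A pair of partial maps from the vertices and edges of a query graph to those of a host graph.
A morphism defined on a subgraph `S` of the query graph is such a pair with domain `S`. -/
abbrev PMap (VQ EQ VH EH : Type*) : Type _ := (VQ → Option VH) × (EQ → Option EH)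

namespace PMap

variable {VQ EQ VH EH : Type*} {G : DirGraph VQ EQ}

open Classical in
/-- The restriction `m|_S`. -/
noncomputable def restrict (m : PMap VQ EQ VH EH) (S : Subgraph G) : PMap VQ EQ VH EH :=
  (fun v => if v ∈ S.verts then m.1 v else none, fun e => if e ∈ S.edges then m.2 e else none)

/-- The union of two partial maps (used only for maps that agree on their common domain). -/
def union (m m' : PMap VQ EQ VH EH) : PMap VQ EQ VH EH :=
  (fun v => m.1 v <|> m'.1 v, fun e => m.2 e <|> m'.2 e)

/-- The size `|m|`: the number of vertices plus the number of edges in the domain. -/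
noncomputable def size (m : PMap VQ EQ VH EH) : ℕ :=
  {v | (m.1 v).isSome}.ncard + {e | (m.2 e).isSome}.ncard

end PMap

section Matches

variable {TV TE VQ EQ VH EH : Type*} {TG : DirGraph TV TE}

/-- The set of all matches (typed graph morphisms) from the subgraph `S` of `Q` into the
subgraph `K` of `H`. -/
def allMatches (Q : TypedGraph TG VQ EQ) (H : TypedGraph TG VH EH)
    (S : Subgraph Q.toDirGraph) (K : Subgraph H.toDirGraph) : Set (PMap VQ EQ VH EH) :=
  {m | (∀ v, (m.1 v).isSome ↔ v ∈ S.verts) ∧ (∀ e, (m.2 e).isSome ↔ e ∈ S.edges) ∧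
    (∀ v x, m.1 v = some x → x ∈ K.verts ∧ H.vtype x = Q.vtype v) ∧
    (∀ e y, m.2 e = some y → y ∈ K.edges ∧ H.etype y = Q.etype e ∧
      m.1 (Q.src e) = some (H.src y) ∧ m.1 (Q.tgt e) = some (H.tgt y))}

end Matches

/-! ### Well-formed RETE nets -/

/-- A tree of join nodes over edge input nodes; its root is the production node. -/
inductive JoinTree (E : Type*) where
  | input (e : E)
  | join (l r : JoinTree E)

namespace JoinTree

variable {V E : Type*}

/-- The height of the join tree. -/
def height : JoinTree E → ℕ
  | input _ => 0
  | join l r => max l.height r.height + 1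

/-- The query subgraph associated with the root. -/
def query (G : DirGraph V E) : JoinTree E → Subgraph G
  | input e => Subgraph.ofEdge G e
  | join l r => l.query G ⊔ r.query G

/-- The query subgraphs of the two dependencies of every join share a vertex and are simpler than
(proper subgraphs of) the query subgraph of the join. -/
def WellFormed (G : DirGraph V E) : JoinTree E → Prop
  | input _ => True
  | join l r => l.WellFormed G ∧ r.WellFormed G ∧ (l.query G ⊓ r.query G).verts.Nonempty ∧
      l.query G ≠ l.query G ⊔ r.query G ∧ r.query G ≠ l.query G ⊔ r.query G

/-- The nodes of the tree, addressed by the path from the root (`false`: left, `true`: right). -/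
def nodes : JoinTree E → Finset (List Bool)
  | input _ => {[]}
  | join l r => {[]} ∪ (l.nodes.image (List.cons false) ∪ r.nodes.image (List.cons true))

/-- The subtree whose root is the node with the given address. -/
def subtree : JoinTree E → List Bool → Option (JoinTree E)
  | t, [] => some t
  | input _, _ :: _ => none
  | join l _, false :: p => l.subtree p
  | join _ r, true :: p => r.subtree p

section Standard

variable {TV TE VH EH : Type*} {TG : DirGraph TV TE}

/-- The target result set of a node of the (standard) RETE net in the configuration `C`. -/
def results (t : JoinTree E) (Q : TypedGraph TG V E) (H : TypedGraph TG VH EH)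
    (C : List Bool → Set (PMap V E VH EH)) (p : List Bool) : Set (PMap V E VH EH) :=
  match t.subtree p with
  | none => ∅
  | some (input e) => allMatches Q H (Subgraph.ofEdge Q.toDirGraph e) ⊤
  | some (join l r) =>
      {m | ∃ ml ∈ C (p ++ [false]), ∃ mr ∈ C (p ++ [true]),
        ml.restrict (l.query Q.toDirGraph ⊓ r.query Q.toDirGraph)
          = mr.restrict (l.query Q.toDirGraph ⊓ r.query Q.toDirGraph) ∧ m = ml.union mr}

/-- `C` is a consistent configuration of the RETE net for the host graph `H`. -/
def Consistent (t : JoinTree E) (Q : TypedGraph TG V E) (H : TypedGraph TG VH EH)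
    (C : List Bool → Set (PMap V E VH EH)) : Prop :=
  ∀ p ∈ t.nodes, C p = t.results Q H C p

/-- The total number `T` of matches in a configuration. -/
noncomputable def totalMatches (t : JoinTree E) (C : List Bool → Set (PMap V E VH EH)) : ℕ :=
  ∑ p ∈ t.nodes, (C p).ncard

/-- The average size `|Q_a|` of the matches in a configuration (`0` if there are none). -/
noncomputable def averageMatchSize (t : JoinTree E) (C : List Bool → Set (PMap V E VH EH)) : ℝ :=
  ((∑ p ∈ t.nodes, ∑ᶠ m ∈ C p, m.size : ℕ) : ℝ) / (t.totalMatches C : ℝ)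

end Standard

end JoinTree

/-! ### Marking-sensitive RETE nets -/

/-- The kinds of marking-sensitive RETE nodes, with their dependencies. A `navigation` node is
associated with a single edge and its dependency with one of the two adjacent vertices: it is a
forward navigation node if that vertex is the source, a backward one if it is the target. -/
inductive NodeKind (ι : Type*) where
  | vertexInput
  | union (deps : Finset ι)
  | navigation (dep : ι)
  | projection (dep : ι)
  | assignment (x : ℕ∞) (dep : ι)
  | filter (x : ℕ∞) (dep : ι)
  | join (l r : ι)

/-- A marking-sensitive RETE graph for the query graph `G`: nodes, their kinds and dependencies,
and their associated query subgraphs. -/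
structure MarkingNet {V E : Type*} (G : DirGraph V E) (ι : Type*) where
  nodes : Finset ι
  kind : ι → NodeKind ι
  query : ι → Subgraph G

/-- The set of dependencies of a node. -/
def MarkingNet.deps {V E ι : Type*} {G : DirGraph V E} (N : MarkingNet G ι) (n : ι) : Set ι :=
  match N.kind n with
  | .vertexInput => ∅
  | .union D => D
  | .navigation d => {d}
  | .projection d => {d}
  | .assignment _ d => {d}
  | .filter _ d => {d}
  | .join l r => {l, r}

namespace MarkingNet

variable {TV TE VQ EQ VH EH ι : Type*} {TG : DirGraph TV TE}

/-- The target result set of a marking-sensitive node for host graph `H`, relevant subgraph `Hp`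
and marking-sensitive configuration `C`. -/
def results {Q : TypedGraph TG VQ EQ} (N : MarkingNet Q.toDirGraph ι) (H : TypedGraph TG VH EH)
    (Hp : Subgraph H.toDirGraph) (C : ι → Set (PMap VQ EQ VH EH × ℕ∞)) (n : ι) :
    Set (PMap VQ EQ VH EH × ℕ∞) :=
  match N.kind n with
  | .vertexInput => {a | a.1 ∈ allMatches Q H (N.query n) Hp ∧ a.2 = ⊤}
  | .union D => {a | IsGreatest {φ | ∃ d ∈ D, (a.1, φ) ∈ C d} a.2}
  | .navigation d =>
      {a | a.1 ∈ allMatches Q H (N.query n) ⊤ ∧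
        IsGreatest {φ | (a.1.restrict (N.query d), φ) ∈ C d} a.2}
  | .projection d =>
      {a | ∃ m, a.1 = m.restrict (N.query n) ∧ (m, a.2) ∈ C d ∧
        IsGreatest {φ | ∃ m', (m', φ) ∈ C d ∧ m'.restrict (N.query n) = m.restrict (N.query n)} a.2}
  | .assignment x d => {a | (∃ φ, (a.1, φ) ∈ C d) ∧ a.2 = x}
  | .filter x d => {a | a ∈ C d ∧ x < a.2}
  | .join l r =>
      {a | ∃ b ∈ C l, ∃ c ∈ C r,
        b.1.restrict (N.query l ⊓ N.query r) = c.1.restrict (N.query l ⊓ N.query r) ∧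
        a = (b.1.union c.1, max b.2 c.2)}

open Classical in
/-- The configuration after executing the nodes in the list `O` one after the other: executing a
node replaces its current result set by its target result set. -/
noncomputable def execute {Q : TypedGraph TG VQ EQ} (N : MarkingNet Q.toDirGraph ι)
    (H : TypedGraph TG VH EH) (Hp : Subgraph H.toDirGraph) (O : List ι)
    (C : ι → Set (PMap VQ EQ VH EH × ℕ∞)) : ι → Set (PMap VQ EQ VH EH × ℕ∞) :=
  O.foldl (fun C n => Function.update C n (N.results H Hp C n)) C

/-- `O` lists the nodes in `S` without repetition such that no node precedes one of its
dependencies. -/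
def IsReverseToposort {Q : DirGraph VQ EQ} (N : MarkingNet Q ι) (S : Set ι) (O : List ι) : Prop :=
  O.Nodup ∧ (∀ n, n ∈ O ↔ n ∈ S) ∧ O.Pairwise (fun a b => b ∉ N.deps a)

end MarkingNet

/-! ### Localization -/

/-- The two ends of an edge. -/
inductive EdgeEnd where
  | source
  | target
  deriving DecidableEq

/-- The vertex at the given end of an edge. -/
def DirGraph.endpoint {V E : Type*} (G : DirGraph V E) : EdgeEnd → E → V
  | .source => G.src
  | .target => G.tgt

/-- The role of a node of a localized net. The first four make up the local navigation structure of
an edge input `v → w`: vertex inputs, union nodes above them (the extension points), navigation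
nodes (`source` for `v`, `target` for `w`), and the final union. The others belong to a join: the
join itself and the two request projection structures, where `false` stands for the one fed by the
left dependency and `true` for the one fed by the right dependency. -/
inductive Role where
  | vertexInput (x : EdgeEnd)
  | extension (x : EdgeEnd)
  | navigation (x : EdgeEnd)
  | union
  | join
  | filter (b : Bool)
  | projection (b : Bool)
  | assignment (b : Bool)
  deriving DecidableEq

/-- A node of a localized net: the node of the original net it belongs to, and its role. -/
abbrev LocalNode : Type := List Bool × Role

/-- The choices made for a request projection structure: the vertex it projects to, and the
extension point of the opposite subtree to which it is connected, given by the address of a leaf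
relative to the root of that subtree and by an end of the edge at that leaf. -/
structure Request (V : Type*) where
  vertex : V
  leaf : List Bool
  ending : EdgeEnd

namespace JoinTree

variable {V E : Type*}

/-- The choices are admissible: the vertex lies in the overlap of the two query subgraphs of the
join, and the extension point belongs to a leaf in the opposite subtree and to that vertex. -/
def ValidRequests (t : JoinTree E) (G : DirGraph V E) (req : List Bool → Bool → Request V) : Prop :=
  ∀ p l r, t.subtree p = some (join l r) → ∀ b : Bool,
    (req p b).vertex ∈ (l.query G ⊓ r.query G).verts ∧
    ∃ e, (if b then l else r).subtree (req p b).leaf = some (input e) ∧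
      G.endpoint (req p b).ending e = (req p b).vertex

/-- The node of the localized net that corresponds to the node `p` of the original net. -/
def localRoot (t : JoinTree E) (p : List Bool) : LocalNode :=
  match t.subtree p with
  | some (join _ _) => (p, .join)
  | _ => (p, .union)

/-- The local navigation structure at the leaf `p`. -/
def navigationStructure (p : List Bool) : Finset LocalNode :=
  {(p, .vertexInput .source), (p, .vertexInput .target), (p, .extension .source),
    (p, .extension .target), (p, .navigation .source), (p, .navigation .target), (p, .union)}

/-- The nodes added for the join `p`: the marking-sensitive join and two request projection
structures. -/
def joinStructure (p : List Bool) : Finset LocalNode :=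
  {(p, .join), (p, .filter false), (p, .projection false), (p, .assignment false),
    (p, .filter true), (p, .projection true), (p, .assignment true)}

open Classical in
/-- The marking assignment nodes that are connected to the extension point for the end `x` of the
edge at the leaf `p`. The request projection structure `b` of the join `q` is connected to an
extension point in the subtree `!b` of `q`. -/
noncomputable def requestsAt (t : JoinTree E) (req : List Bool → Bool → Request V)
    (p : List Bool) (x : EdgeEnd) : Finset LocalNode :=
  ((t.nodes ×ˢ (Finset.univ : Finset Bool)).filter fun a =>
    (∃ l r, t.subtree a.1 = some (join l r)) ∧
      a.1 ++ (!a.2) :: (req a.1 a.2).leaf = p ∧ (req a.1 a.2).ending = x).image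
    fun a => (a.1, Role.assignment a.2)

/-- The localized RETE net. Labels of pairs that are not nodes are irrelevant. -/
noncomputable def localize (t : JoinTree E) (G : DirGraph V E)
    (req : List Bool → Bool → Request V) : MarkingNet G LocalNode where
  nodes := t.nodes.biUnion fun p =>
    match t.subtree p with
    | some (input _) => navigationStructure p
    | some (join _ _) => joinStructure p
    | none => ∅
  kind n :=
    match t.subtree n.1, n.2 with
    | some (input _), .vertexInput _ => .vertexInput
    | some (input _), .extension x => .union (insert (n.1, .vertexInput x) (t.requestsAt req n.1 x))
    | some (input _), .navigation x => .navigation (n.1, .extension x)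
    | some (input _), .union => .union {(n.1, .navigation .source), (n.1, .navigation .target)}
    | some (join _ _), .join => .join (t.localRoot (n.1 ++ [false])) (t.localRoot (n.1 ++ [true]))
    | some (join l r), .filter b => .filter (join l r).height (t.localRoot (n.1 ++ [b]))
    | some (join _ _), .projection b => .projection (n.1, .filter b)
    | some (join l r), .assignment b => .assignment (join l r).height (n.1, .projection b)
    | _, _ => .union ∅
  query n :=
    match t.subtree n.1, n.2 with
    | some (input e), .vertexInput x => Subgraph.ofVertex G (G.endpoint x e)
    | some (input e), .extension x => Subgraph.ofVertex G (G.endpoint x e)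
    | some (input e), .navigation _ => Subgraph.ofEdge G e
    | some (input e), .union => Subgraph.ofEdge G e
    | some (join l r), .join => (join l r).query G
    | some (join l r), .filter b => (if b then r else l).query G
    | some (join _ _), .projection b => Subgraph.ofVertex G (req n.1 b).vertex
    | some (join _ _), .assignment b => Subgraph.ofVertex G (req n.1 b).vertex
    | _, _ => ⊥

/-- The reverse topological sorting of the request projection structure `b` of the join `p`. -/
def requestOrder (p : List Bool) (b : Bool) : List LocalNode :=
  [(p, .filter b), (p, .projection b), (p, .assignment b)]

/-- The execution order of the localization of the subtree with root address `p`, where `sort q` is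
a reverse topological sorting of the local navigation structure at the leaf `q`. -/
def order (sort : List Bool → List LocalNode) : JoinTree E → List Bool → List LocalNode
  | input _, p => sort p
  | join l r, p =>
      requestOrder p true ++ l.order sort (p ++ [false]) ++
      requestOrder p false ++ r.order sort (p ++ [true]) ++
      requestOrder p true ++ l.order sort (p ++ [false]) ++ [(p, .join)]

end JoinTree

/-! ### The execution procedure and its step count

Nodes are executed incrementally. Each node keeps its current result set, in which a match has at
most one marking, and a chronological record of the changes to it. Each dependent node remembers how
much of that record it has handled. The elementary operations and their costs are:

* handling a newly added match `m` of a dependency (retrieval in an index): `|m|` steps;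
* constructing a match `m`, looking it up in a result set and inserting it or increasing its
  marking: `|m| + 1` steps;
* handling the increase of the marking of a match of a dependency: `1` step, and `1` more step for
  each associated result match, which is reached by a stored reference;
* being notified by a dependency: `1` step. Nodes without a notification are skipped.
-/

/-- A recorded change of a result set: a match with a marking was added, or the marking of a match
was increased to a new value. -/
inductive Change (M : Type*) where
  | added (m : M) (φ : ℕ∞)
  | raised (m : M) (φ : ℕ∞)

/-- The state of the execution procedure. -/
structure Memory (ι M : Type*) where
  /-- the marking of a match in the current result set of a node, `none` if it is not in there -/
  marking : ι → M → Option ℕ∞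
  /-- the changes of the result set of a node, in chronological order -/
  changes : ι → List (Change M)
  /-- `handled n d`: how many changes of its dependency `d` the node `n` has handled -/
  handled : ι → ι → ℕ
  /-- whether a vertex input node has been executed -/
  loaded : ι → Bool
  /-- the number of steps so far -/
  steps : ℕ

namespace Memory

variable {ι M : Type*}

/-- The initial state: empty result sets, nothing executed. -/
def empty : Memory ι M := ⟨fun _ _ => none, fun _ => [], fun _ _ => 0, fun _ => false, 0⟩

/-- The configuration represented by the state. -/
def config (s : Memory ι M) : ι → Set (M × ℕ∞) := fun n => {a | s.marking n a.1 = some a.2}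

/-- The matches in the current result set of `n`. -/
def stored (s : Memory ι M) (n : ι) : Set M := {m | (s.marking n m).isSome}

/-- Let `k` steps pass. -/
def tick (s : Memory ι M) (k : ℕ) : Memory ι M := { s with steps := s.steps + k }

open Classical in
/-- Set the marking of `m` at node `n` to `φ` and record the change `c`. -/
noncomputable def record (s : Memory ι M) (n : ι) (m : M) (φ : ℕ∞) (c : Change M) : Memory ι M :=
  { s with
    marking := Function.update s.marking n (Function.update (s.marking n) m (some φ))
    changes := Function.update s.changes n (s.changes n ++ [c]) }

open Classical in
/-- Insert `m` with marking `φ` at node `n` if it is not there; otherwise increase its marking to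
`φ` if that is higher. -/
noncomputable def write (s : Memory ι M) (n : ι) (m : M) (φ : ℕ∞) : Memory ι M :=
  match s.marking n m with
  | none => s.record n m φ (.added m φ)
  | some ψ => if ψ < φ then s.record n m φ (.raised m φ) else s

end Memory

open Classical in
/-- A list of the elements of a set, each occurring once. -/
noncomputable def enumerate {α : Type*} [Finite α] (s : Set α) : List α :=
  s.toFinite.toFinset.toList

namespace MarkingNet

variable {TV TE VQ EQ VH EH ι : Type*} {TG : DirGraph TV TE}
  [Finite VQ] [Finite EQ] [Finite VH] [Finite EH]
  {Q : TypedGraph TG VQ EQ}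

open Classical in
/-- The marked results of `n` that arise from a match `m` with marking `φ` that was added to the
result set of the dependency `d`. Navigation nodes retrieve the adjacent edges from `H`, join nodes
the complementary matches from the result set of the other dependency. -/
noncomputable def newResults (N : MarkingNet Q.toDirGraph ι) (H : TypedGraph TG VH EH)
    (s : Memory ι (PMap VQ EQ VH EH)) (n d : ι) (m : PMap VQ EQ VH EH) (φ : ℕ∞) :
    List (PMap VQ EQ VH EH × ℕ∞) :=
  match N.kind n with
  | .vertexInput => []
  | .union _ => [(m, φ)]
  | .navigation _ =>
      (enumerate {m' | m' ∈ allMatches Q H (N.query n) ⊤ ∧ m'.restrict (N.query d) = m}).map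
        fun m' => (m', φ)
  | .projection _ => [(m.restrict (N.query n), φ)]
  | .assignment x _ => [(m, x)]
  | .filter x _ => if x < φ then [(m, φ)] else []
  | .join l r =>
      (enumerate {m' | m' ∈ s.stored (if d = l then r else l) ∧
          m'.restrict (N.query l ⊓ N.query r) = m.restrict (N.query l ⊓ N.query r)}).map
        fun m' => (m.union m', max φ ((s.marking (if d = l then r else l) m').getD 0))

open Classical in
/-- The results of `n` whose marking may have to be increased when the marking of the match `m` in
the result set of the dependency `d` has been increased to `φ`. A filter keeps the matches with a
too low marking aside, with their insertion position, and so reaches these by a reference, too. -/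
noncomputable def associatedResults (N : MarkingNet Q.toDirGraph ι)
    (s : Memory ι (PMap VQ EQ VH EH)) (n d : ι) (m : PMap VQ EQ VH EH) (φ : ℕ∞) :
    List (PMap VQ EQ VH EH) :=
  match N.kind n with
  | .vertexInput => []
  | .union _ => [m]
  | .navigation _ => enumerate {m' | m' ∈ s.stored n ∧ m'.restrict (N.query d) = m}
  | .projection _ => [m.restrict (N.query n)]
  | .assignment _ _ => []
  | .filter x _ => if x < φ then [m] else []
  | .join _ _ => enumerate {m' | m' ∈ s.stored n ∧ m'.restrict (N.query d) = m}

/-- Construct and look up each of the given marked matches, and insert it or adapt its marking. -/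
noncomputable def offerAll (n : ι) (L : List (PMap VQ EQ VH EH × ℕ∞))
    (s : Memory ι (PMap VQ EQ VH EH)) : Memory ι (PMap VQ EQ VH EH) :=
  L.foldl (fun s a => (s.tick (a.1.size + 1)).write n a.1 a.2) s

/-- Adapt the marking of each of the given matches, which are reached by references. -/
noncomputable def raiseAll (n : ι) (L : List (PMap VQ EQ VH EH)) (φ : ℕ∞)
    (s : Memory ι (PMap VQ EQ VH EH)) : Memory ι (PMap VQ EQ VH EH) :=
  L.foldl (fun s m => (s.tick 1).write n m φ) s

/-- Node `n` handles one change of its dependency `d`. -/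
noncomputable def handleChange (N : MarkingNet Q.toDirGraph ι) (H : TypedGraph TG VH EH) (n d : ι)
    (s : Memory ι (PMap VQ EQ VH EH)) :
    Change (PMap VQ EQ VH EH) → Memory ι (PMap VQ EQ VH EH)
  | .added m φ => offerAll n (N.newResults H s n d m φ) (s.tick m.size)
  | .raised m φ => raiseAll n (N.associatedResults s n d m φ) φ (s.tick 1)

open Classical in
/-- Node `n` handles all changes of its dependency `d` that it has not handled yet. -/
noncomputable def handleDep (N : MarkingNet Q.toDirGraph ι) (H : TypedGraph TG VH EH) (n : ι)
    (s : Memory ι (PMap VQ EQ VH EH)) (d : ι) : Memory ι (PMap VQ EQ VH EH) :=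
  let pending := (s.changes d).drop (s.handled n d)
  if pending = [] then s
  else
    pending.foldl (N.handleChange H n d)
      { s.tick 1 with
        handled := Function.update s.handled n
          (Function.update (s.handled n) d (s.changes d).length) }

open Classical in
/-- Execute one node. A vertex input node retrieves the matching vertices of `Hp` when it is
executed for the first time; the other nodes handle the changes of their dependencies. -/
noncomputable def runNode (N : MarkingNet Q.toDirGraph ι) (H : TypedGraph TG VH EH)
    (Hp : Subgraph H.toDirGraph) (s : Memory ι (PMap VQ EQ VH EH)) (n : ι) :
    Memory ι (PMap VQ EQ VH EH) :=
  match N.kind n with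
  | .vertexInput =>
      if s.loaded n then s
      else
        offerAll n ((enumerate (allMatches Q H (N.query n) Hp)).map fun m => (m, ⊤))
          { s with loaded := Function.update s.loaded n true }
  | .union D => D.toList.foldl (N.handleDep H n) s
  | .navigation d => N.handleDep H n s d
  | .projection d => N.handleDep H n s d
  | .assignment _ d => N.handleDep H n s d
  | .filter _ d => N.handleDep H n s d
  | .join l r => N.handleDep H n (N.handleDep H n s l) r

/-- Execute the nodes in the list `O` one after the other, starting with empty result sets. -/
noncomputable def run (N : MarkingNet Q.toDirGraph ι) (H : TypedGraph TG VH EH)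
    (Hp : Subgraph H.toDirGraph) (O : List ι) : Memory ι (PMap VQ EQ VH EH) :=
  O.foldl (N.runNode H Hp) Memory.empty

end MarkingNet

end Rete

universe u₁ u₂ u₃ u₄ u₅ u₆

/-!
The result sets of the localized net never leave the match sets of the original net, restricted to
single vertices in the request projection structures. A match is inserted into a result set at most
once, and its marking can only increase within `{0, …, h} ∪ {∞}`, where `h` is the height of the
join tree. Hence handling a match costs a node at most a constant times `|m| + h + 2`, in whatever
order and however often the nodes are executed, and `h + 2 ≤ |Q|` because the query subgraphs grow
strictly along every path to the root. The vertex matches are charged to edge matches by edge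
dominance, and every join result is used by at most one join and one request projection structure.

That the incremental procedure computes the right configuration follows from an invariant: a result
set always equals the target result set for the changes of the dependencies handled so far.
-/

namespace Rete

/-! ### Change logs -/

namespace Change

variable {M : Type*}

/-- The match a change is about. -/
def item : Change M → M
  | added m _ => m
  | raised m _ => m

/-- The marking of the match after the change. -/
def value : Change M → ℕ∞
  | added _ φ => φ
  | raised _ φ => φ

/-- The change is possible in a result set with markings `f`. -/
def Fits (f : M → Option ℕ∞) : Change M → Prop
  | added m _ => f m = none
  | raised m φ => ∃ ψ, f m = some ψ ∧ ψ < φ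

end Change

section Markings

variable {M : Type*} {f g h : M → Option ℕ∞}

/-- The marked match `a` occurs in the result set `f` with at least its marking. -/
def Covers (f : M → Option ℕ∞) (a : M × ℕ∞) : Prop := ∃ ψ, f a.1 = some ψ ∧ a.2 ≤ ψ

/-- The order on result sets in which they grow during an execution: every marked match in `f`
occurs in `g` with at least its marking. -/
def Dominated (f g : M → Option ℕ∞) : Prop := ∀ m φ, f m = some φ → Covers g (m, φ)

theorem Covers.mono {a : M × ℕ∞} (ha : Covers f a) (hfg : Dominated f g) : Covers g a := by
  obtain ⟨φ, hφ, hle⟩ := ha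
  obtain ⟨ψ, hψ, hle'⟩ := hfg _ _ hφ
  exact ⟨ψ, hψ, hle.trans hle'⟩

theorem Covers.of_le {m : M} {φ ψ : ℕ∞} (hm : Covers f (m, ψ)) (hle : φ ≤ ψ) :
    Covers f (m, φ) := by
  obtain ⟨χ, hχ, hle'⟩ := hm
  exact ⟨χ, hχ, hle.trans hle'⟩

theorem Covers.max {m : M} {φ ψ : ℕ∞} (hφ : Covers f (m, φ)) (hψ : Covers f (m, ψ)) :
    Covers f (m, max φ ψ) := by
  rcases max_choice φ ψ with e | e <;> rw [e] <;> assumption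

theorem Dominated.refl (f : M → Option ℕ∞) : Dominated f f := fun _ φ hφ => ⟨φ, hφ, le_rfl⟩

theorem Dominated.trans (hfg : Dominated f g) (hgh : Dominated g h) : Dominated f h :=
  fun m φ hφ => (hfg m φ hφ).mono hgh

open Classical in
theorem Change.Fits.dominated {c : Change M} (hc : c.Fits f) :
    Dominated f (Function.update f c.item (some c.value)) := by
  intro m φ hφ
  by_cases hm : m = c.item
  · subst hm
    refine ⟨c.value, by simp, ?_⟩
    cases c with
    | added => exact absurd (hφ.symm.trans hc) (by simp)
    | raised =>
      obtain ⟨ψ, hψ, hlt⟩ := hc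
      obtain rfl : φ = ψ := Option.some.inj (hφ.symm.trans hψ)
      exact hlt.le
  · exact ⟨φ, by simp [hm, hφ], le_rfl⟩

open Classical in
/-- The markings after the changes in the list `L`, starting with an empty result set. -/
noncomputable def replay (L : List (Change M)) : M → Option ℕ∞ :=
  L.foldl (fun f c => Function.update f c.item (some c.value)) fun _ => none

open Classical in
theorem replay_concat (L : List (Change M)) (c : Change M) :
    replay (L ++ [c]) = Function.update (replay L) c.item (some c.value) := by
  simp [replay]

theorem exists_mem_of_replay_eq_some {L : List (Change M)} {m : M} {φ : ℕ∞}
    (hφ : replay L m = some φ) : ∃ c ∈ L, c.item = m ∧ c.value = φ := by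
  induction L using List.reverseRecOn with
  | nil => simp [replay] at hφ
  | append_singleton L c ih =>
    rw [replay_concat] at hφ
    by_cases hm : m = c.item
    · subst hm
      exact ⟨c, by simp, rfl, by simpa using hφ⟩
    · obtain ⟨c', hc', h⟩ := ih (by simpa [hm] using hφ)
      exact ⟨c', by simp [hc'], h⟩

/-- A change log in which every change is possible at the time when it occurs. -/
def ValidLog (L : List (Change M)) : Prop := ∀ L' c, L' ++ [c] <+: L → c.Fits (replay L')

namespace ValidLog

variable {L L' : List (Change M)} {c : Change M}

theorem nil : ValidLog ([] : List (Change M)) := fun _ _ h => by simp at h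

theorem of_isPrefix (hL : ValidLog L) (hp : L' <+: L) : ValidLog L' :=
  fun L₁ c hc => hL L₁ c (hc.trans hp)

theorem concat (hL : ValidLog L) (hc : c.Fits (replay L)) : ValidLog (L ++ [c]) := by
  intro L' c' hp
  rcases List.prefix_concat_iff.1 hp with e | hp
  · obtain ⟨rfl, hc'⟩ := List.append_inj' e rfl
    rwa [List.singleton_inj.1 hc']
  · exact hL _ _ hp

theorem replay_dominated (hL : ValidLog L) (hp : L' <+: L) :
    Dominated (replay L') (replay L) := by
  induction L using List.reverseRecOn with
  | nil => rw [List.prefix_nil.1 hp]; exact .refl _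
  | append_singleton L c ih =>
    rcases List.prefix_concat_iff.1 hp with e | hp'
    · rw [e]; exact .refl _
    · rw [replay_concat]
      exact (ih (hL.of_isPrefix (List.prefix_append _ _)) hp').trans
        (hL L c (List.prefix_refl _)).dominated

theorem covers (hL : ValidLog L) (hp : L' ++ [c] <+: L) :
    Covers (replay L) (c.item, c.value) := by
  have hlast : Covers (replay (L' ++ [c])) (c.item, c.value) :=
    ⟨c.value, by simp [replay_concat], le_rfl⟩
  exact hlast.mono (hL.replay_dominated hp)

end ValidLog

end Markings

/-! ### Writing to the memory -/

namespace Memory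

variable {ι M : Type*} {s s' s'' : Memory ι M} {n : ι}

/-- The logs are valid and describe the current result sets. -/
def LogsValid (s : Memory ι M) : Prop :=
  ∀ d, ValidLog (s.changes d) ∧ replay (s.changes d) = s.marking d

theorem LogsValid.covers (hs : s.LogsValid) {d : ι} {L : List (Change M)} {c : Change M}
    (hp : L ++ [c] <+: s.changes d) : Covers (s.marking d) (c.item, c.value) :=
  (hs d).2 ▸ (hs d).1.covers hp

theorem LogsValid.replay_dominated (hs : s.LogsValid) {d : ι} {L : List (Change M)}
    (hp : L <+: s.changes d) : Dominated (replay L) (s.marking d) :=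
  (hs d).2 ▸ (hs d).1.replay_dominated hp

/-- The state `s'` arises from `s` by growth of the result set of `n` alone. -/
structure Grows (n : ι) (s s' : Memory ι M) : Prop where
  marking_of_ne : ∀ k, k ≠ n → s'.marking k = s.marking k
  changes_of_ne : ∀ k, k ≠ n → s'.changes k = s.changes k
  handled : s'.handled = s.handled
  loaded : s'.loaded = s.loaded
  dominated : ∀ k, Dominated (s.marking k) (s'.marking k)
  isPrefix : ∀ k, s.changes k <+: s'.changes k

theorem Grows.refl (n : ι) (s : Memory ι M) : Grows n s s :=
  ⟨fun _ _ => rfl, fun _ _ => rfl, rfl, rfl, fun _ => .refl _, fun _ => List.prefix_refl _⟩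

theorem Grows.trans (h : Grows n s s') (h' : Grows n s' s'') : Grows n s s'' where
  marking_of_ne k hk := (h'.marking_of_ne k hk).trans (h.marking_of_ne k hk)
  changes_of_ne k hk := (h'.changes_of_ne k hk).trans (h.changes_of_ne k hk)
  handled := h'.handled.trans h.handled
  loaded := h'.loaded.trans h.loaded
  dominated k := (h.dominated k).trans (h'.dominated k)
  isPrefix k := (h.isPrefix k).trans (h'.isPrefix k)

theorem Grows.tick (h : Grows n s s') (k : ℕ) : Grows n s (s'.tick k) :=
  ⟨h.1, h.2, h.3, h.4, h.5, h.6⟩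

theorem tick_tick (s : Memory ι M) (k l : ℕ) : (s.tick k).tick l = s.tick (k + l) := by
  simp [tick, Nat.add_assoc]

theorem write_tick (s : Memory ι M) (n : ι) (m : M) (φ : ℕ∞) (k : ℕ) :
    (s.tick k).write n m φ = (s.write n m φ).tick k := by
  have e : (s.tick k).marking = s.marking := rfl
  unfold write
  rw [e]
  cases s.marking n m with
  | none => rfl
  | some ψ => dsimp only; split_ifs <;> rfl

theorem grows_record {c : Change M} (hc : c.Fits (s.marking n)) :
    Grows n s (s.record n c.item c.value c) where
  marking_of_ne k hk := by simp [record, hk]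
  changes_of_ne k hk := by simp [record, hk]
  handled := rfl
  loaded := rfl
  dominated k := by
    by_cases hk : k = n
    · subst hk; simpa [record] using hc.dominated
    · simpa [record, hk] using Dominated.refl _
  isPrefix k := by by_cases hk : k = n <;> simp [record, hk]

theorem LogsValid.record (hs : s.LogsValid) {c : Change M} (hc : c.Fits (s.marking n)) :
    (s.record n c.item c.value c).LogsValid := by
  intro d
  by_cases hd : d = n
  · subst hd
    obtain ⟨hvalid, hreplay⟩ := hs d
    refine ⟨by simpa [Memory.record] using hvalid.concat (hreplay.symm ▸ hc), ?_⟩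
    simp [Memory.record, replay_concat, hreplay]
  · simpa [Memory.record, hd] using hs d

theorem write_cases (s : Memory ι M) (n : ι) (m : M) (φ : ℕ∞) :
    (s.write n m φ = s ∧ Covers (s.marking n) (m, φ)) ∨
      ∃ c : Change M, c.item = m ∧ c.value = φ ∧ c.Fits (s.marking n) ∧
        s.write n m φ = s.record n c.item c.value c := by
  unfold write
  cases h : s.marking n m with
  | none => exact Or.inr ⟨.added m φ, rfl, rfl, h, rfl⟩
  | some ψ =>
    dsimp only
    split_ifs with hlt
    · exact Or.inr ⟨.raised m φ, rfl, rfl, ⟨ψ, h, hlt⟩, rfl⟩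
    · exact Or.inl ⟨rfl, ψ, h, not_lt.1 hlt⟩

theorem grows_write (s : Memory ι M) (n : ι) (m : M) (φ : ℕ∞) : Grows n s (s.write n m φ) := by
  rcases s.write_cases n m φ with ⟨e, _⟩ | ⟨c, _, _, hc, e⟩ <;> rw [e]
  · exact .refl n s
  · exact grows_record hc

theorem LogsValid.write (hs : s.LogsValid) (n : ι) (m : M) (φ : ℕ∞) :
    (s.write n m φ).LogsValid := by
  rcases s.write_cases n m φ with ⟨e, _⟩ | ⟨c, _, _, hc, e⟩ <;> rw [e]
  · exact hs
  · exact hs.record hc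

theorem covers_write (s : Memory ι M) (n : ι) (m : M) (φ : ℕ∞) :
    Covers ((s.write n m φ).marking n) (m, φ) := by
  rcases s.write_cases n m φ with ⟨e, h⟩ | ⟨c, rfl, rfl, _, e⟩ <;> rw [e]
  · exact h
  · exact ⟨c.value, by simp [record], le_rfl⟩

theorem mem_changes_write {m : M} {φ : ℕ∞} {c : Change M} (hc : c ∈ (s.write n m φ).changes n) :
    c ∈ s.changes n ∨ (c.item, c.value) = (m, φ) := by
  rcases s.write_cases n m φ with ⟨e, _⟩ | ⟨c', rfl, rfl, _, e⟩ <;> rw [e] at hc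
  · exact Or.inl hc
  · simp only [record, Function.update_self, List.mem_append, List.mem_singleton] at hc
    exact hc.imp id fun e => by rw [e]

theorem steps_write (s : Memory ι M) (n : ι) (m : M) (φ : ℕ∞) :
    (s.write n m φ).steps = s.steps := by
  rcases s.write_cases n m φ with ⟨e, _⟩ | ⟨c, _, _, _, e⟩ <;> rw [e]
  rfl

/-- Write all marked matches in a list, without counting steps. -/
noncomputable def writeAll (n : ι) (L : List (M × ℕ∞)) (s : Memory ι M) : Memory ι M :=
  L.foldl (fun s a => s.write n a.1 a.2) s

theorem writeAll_cons (n : ι) (a : M × ℕ∞) (L : List (M × ℕ∞)) (s : Memory ι M) :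
    writeAll n (a :: L) s = writeAll n L (s.write n a.1 a.2) := rfl

theorem writeAll_tick (n : ι) (L : List (M × ℕ∞)) (s : Memory ι M) (k : ℕ) :
    writeAll n L (s.tick k) = (writeAll n L s).tick k := by
  induction L generalizing s with
  | nil => rfl
  | cons a L ih => rw [writeAll_cons, write_tick, ih, writeAll_cons]

theorem steps_writeAll (n : ι) (L : List (M × ℕ∞)) (s : Memory ι M) :
    (writeAll n L s).steps = s.steps := by
  induction L generalizing s with
  | nil => rfl
  | cons a L ih => rw [writeAll_cons, ih, steps_write]

theorem grows_writeAll (n : ι) (L : List (M × ℕ∞)) (s : Memory ι M) :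
    Grows n s (writeAll n L s) := by
  induction L generalizing s with
  | nil => exact .refl n s
  | cons a L ih => exact (s.grows_write n a.1 a.2).trans (ih _)

theorem LogsValid.writeAll (hs : s.LogsValid) (n : ι) (L : List (M × ℕ∞)) :
    (s.writeAll n L).LogsValid := by
  induction L generalizing s with
  | nil => exact hs
  | cons a _ ih => exact ih (hs.write n a.1 a.2)

theorem covers_writeAll (s : Memory ι M) (n : ι) {L : List (M × ℕ∞)} {a : M × ℕ∞} (ha : a ∈ L) :
    Covers ((s.writeAll n L).marking n) a := by
  induction L generalizing s with
  | nil => simp at ha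
  | cons b L ih =>
    rcases List.mem_cons.1 ha with rfl | ha
    · exact (s.covers_write n a.1 a.2).mono ((grows_writeAll n L _).dominated n)
    · exact ih _ ha

theorem mem_changes_writeAll {L : List (M × ℕ∞)} {c : Change M}
    (hc : c ∈ (s.writeAll n L).changes n) : c ∈ s.changes n ∨ (c.item, c.value) ∈ L := by
  induction L generalizing s with
  | nil => exact Or.inl hc
  | cons b _ ih =>
    rcases ih (s := s.write n b.1 b.2) hc with h | h
    · exact (mem_changes_write h).imp id fun e => by simp [e]
    · exact Or.inr (List.mem_cons_of_mem _ h)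

theorem exists_change_of_marking (hs : s.LogsValid) {d : ι} {m : M} {φ : ℕ∞}
    (hφ : s.marking d m = some φ) : ∃ c ∈ s.changes d, c.item = m ∧ c.value = φ :=
  exists_mem_of_replay_eq_some ((hs d).2 ▸ hφ)

end Memory

/-! ### Partial maps -/

namespace PMap

variable {VQ EQ VH EH : Type*} {G : DirGraph VQ EQ} {m m' : PMap VQ EQ VH EH} {A B S : Subgraph G}

/-- The domain of the partial map `m` is the subgraph `S`. -/
def HasDomain (m : PMap VQ EQ VH EH) (S : Subgraph G) : Prop :=
  (∀ v, (m.1 v).isSome ↔ v ∈ S.verts) ∧ ∀ e, (m.2 e).isSome ↔ e ∈ S.edges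

theorem restrict_eq_restrict_iff :
    m.restrict S = m'.restrict S ↔
      (∀ v ∈ S.verts, m.1 v = m'.1 v) ∧ ∀ e ∈ S.edges, m.2 e = m'.2 e := by
  constructor
  · intro h
    refine ⟨fun v hv => ?_, fun e he => ?_⟩
    · simpa [restrict, hv] using congrFun (congrArg Prod.fst h) v
    · simpa [restrict, he] using congrFun (congrArg Prod.snd h) e
  · rintro ⟨hverts, hedges⟩
    refine Prod.ext (funext fun v => ?_) (funext fun e => ?_)
    · by_cases hv : v ∈ S.verts <;> simp [restrict, hv, hverts]
    · by_cases he : e ∈ S.edges <;> simp [restrict, he, hedges]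

theorem HasDomain.size_eq (hm : m.HasDomain S) : m.size = S.verts.ncard + S.edges.ncard := by
  simp only [size, hm.1, hm.2, Set.ofPred_mem_eq]

theorem union_comm (hm : m.HasDomain A) (hm' : m'.HasDomain B)
    (h : m.restrict (A ⊓ B) = m'.restrict (A ⊓ B)) : m.union m' = m'.union m := by
  obtain ⟨hverts, hedges⟩ := restrict_eq_restrict_iff.1 h
  refine Prod.ext (funext fun v => ?_) (funext fun e => ?_)
  · have hdom := hm.1 v
    have hdom' := hm'.1 v
    have hv : v ∈ A.verts ∩ B.verts → _ := hverts v
    cases x : m.1 v <;> cases y : m'.1 v <;> simp_all [union]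
  · have hdom := hm.2 e
    have hdom' := hm'.2 e
    have he : e ∈ A.edges ∩ B.edges → _ := hedges e
    cases x : m.2 e <;> cases y : m'.2 e <;> simp_all [union]

theorem restrict_union_left (hm : m.HasDomain A) : (m.union m').restrict A = m := by
  refine Prod.ext (funext fun v => ?_) (funext fun e => ?_)
  · have hdom := hm.1 v
    by_cases hv : v ∈ A.verts <;> cases x : m.1 v <;> simp_all [union, restrict]
  · have hdom := hm.2 e
    by_cases he : e ∈ A.edges <;> cases x : m.2 e <;> simp_all [union, restrict]

theorem restrict_union_right (hm : m.HasDomain A) (hm' : m'.HasDomain B)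
    (h : m.restrict (A ⊓ B) = m'.restrict (A ⊓ B)) : (m.union m').restrict B = m' := by
  rw [union_comm hm hm' h, restrict_union_left hm']

theorem size_restrict_le [Finite VQ] [Finite EQ] (m : PMap VQ EQ VH EH) (S : Subgraph G) :
    (m.restrict S).size ≤ m.size := by
  refine Nat.add_le_add (Set.ncard_le_ncard (fun v hv => ?_) (Set.toFinite _))
    (Set.ncard_le_ncard (fun e he => ?_) (Set.toFinite _))
  · by_cases h : v ∈ S.verts <;> simp_all [restrict]
  · by_cases h : e ∈ S.edges <;> simp_all [restrict]

end PMap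

/-! ### Candidates for the results of a node -/

section Justified

variable {M : Type*} {S T : Set (M × ℕ∞)} {a : M × ℕ∞}

/-- The match of `a` occurs in `S` with at least the marking of `a`. -/
def Justified (S : Set (M × ℕ∞)) (a : M × ℕ∞) : Prop := ∃ φ, a.2 ≤ φ ∧ (a.1, φ) ∈ S

theorem Justified.of_forall (ha : Justified S a) (h : ∀ b ∈ S, Justified T b) :
    Justified T a := by
  obtain ⟨φ, hle, hφ⟩ := ha
  obtain ⟨ψ, hle', hψ⟩ := h _ hφ
  exact ⟨ψ, hle.trans hle', hψ⟩

theorem setOf_isGreatest_eq_self (hS : ∀ m φ ψ, (m, φ) ∈ S → (m, ψ) ∈ S → φ = ψ) :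
    {a : M × ℕ∞ | IsGreatest {φ | (a.1, φ) ∈ S} a.2} = S :=
  Set.ext fun _ => ⟨fun h => h.1, fun h => ⟨h, fun _ hψ => (hS _ _ _ hψ h).le⟩⟩

end Justified

namespace MarkingNet

variable {TV TE VQ EQ VH EH ι : Type*} {TG : DirGraph TV TE} {Q : TypedGraph TG VQ EQ}

open Classical in
/-- The dependency other than `d` of a join with the dependencies `l` and `r`. -/
noncomputable def otherDep (l r d : ι) : ι := if d = l then r else l

theorem otherDep_left (l r : ι) : otherDep l r l = r := if_pos rfl

theorem otherDep_right {l r : ι} (hne : l ≠ r) : otherDep l r r = l := if_neg hne.symm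

/-- The marked results of `n` that arise from the match `m` with marking `φ` in its dependency `d`,
where the other dependency of a join has the markings `C`. -/
def derived (N : MarkingNet Q.toDirGraph ι) (H : TypedGraph TG VH EH)
    (C : ι → PMap VQ EQ VH EH → Option ℕ∞) (n d : ι) (m : PMap VQ EQ VH EH) (φ : ℕ∞) :
    Set (PMap VQ EQ VH EH × ℕ∞) :=
  match N.kind n with
  | .vertexInput => ∅
  | .union _ => {(m, φ)}
  | .navigation _ =>
      {a | a.1 ∈ allMatches Q H (N.query n) ⊤ ∧ a.1.restrict (N.query d) = m ∧ a.2 = φ}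
  | .projection _ => {(m.restrict (N.query n), φ)}
  | .assignment x _ => {(m, x)}
  | .filter x _ => {a | a = (m, φ) ∧ x < φ}
  | .join l r =>
      {a | ∃ m' φ', C (otherDep l r d) m' = some φ' ∧
        m'.restrict (N.query l ⊓ N.query r) = m.restrict (N.query l ⊓ N.query r) ∧
        a = (m.union m', max φ φ')}

/-- The marked matches that a node computes from the markings `C` of its dependencies, before only
the maximal marking of each match is kept. -/
def candidates (N : MarkingNet Q.toDirGraph ι) (H : TypedGraph TG VH EH)
    (Hp : Subgraph H.toDirGraph) (C : ι → PMap VQ EQ VH EH → Option ℕ∞) (n : ι) :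
    Set (PMap VQ EQ VH EH × ℕ∞) :=
  {a | (N.kind n = .vertexInput ∧ a.1 ∈ allMatches Q H (N.query n) Hp ∧ a.2 = ⊤) ∨
    ∃ d ∈ N.deps n, ∃ m φ, C d m = some φ ∧ a ∈ N.derived H C n d m φ}

/-- The bounding sets `B` of matches and `X` of markings contain what the node `n` computes from
dependencies whose results are in `B` and `X`. At a join, the dependencies must also be distinct and
have matches with the right domains. -/
def ClosedAt (N : MarkingNet Q.toDirGraph ι) (H : TypedGraph TG VH EH) (Hp : Subgraph H.toDirGraph)
    (B : ι → Set (PMap VQ EQ VH EH)) (X : Set ℕ∞) (n : ι) : Prop :=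
  match N.kind n with
  | .vertexInput => allMatches Q H (N.query n) Hp ⊆ B n ∧ ⊤ ∈ X
  | .union D => ∀ d ∈ D, B d ⊆ B n
  | .navigation _ => allMatches Q H (N.query n) ⊤ ⊆ B n
  | .projection d => ∀ m ∈ B d, m.restrict (N.query n) ∈ B n
  | .assignment x d => B d ⊆ B n ∧ x ∈ X
  | .filter _ d => B d ⊆ B n
  | .join l r => l ≠ r ∧ (∀ m ∈ B l, m.HasDomain (N.query l)) ∧
      (∀ m ∈ B r, m.HasDomain (N.query r)) ∧
      ∀ ml ∈ B l, ∀ mr ∈ B r,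
        ml.restrict (N.query l ⊓ N.query r) = mr.restrict (N.query l ⊓ N.query r) →
        ml.union mr ∈ B n

/-- The sets `B n` of matches and the set `X` of markings bound all results of the net: they are
closed under the computations of its nodes, none of which depends on itself. -/
structure Bounds (N : MarkingNet Q.toDirGraph ι) (H : TypedGraph TG VH EH)
    (Hp : Subgraph H.toDirGraph) (B : ι → Set (PMap VQ EQ VH EH)) (X : Set ℕ∞) : Prop where
  notMem_deps : ∀ n, n ∉ N.deps n
  closedAt : ∀ n, N.ClosedAt H Hp B X n

/-- Every match that is marked in `C` belongs to the bounding set `B`. -/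
def InBounds (B : ι → Set (PMap VQ EQ VH EH)) (C : ι → PMap VQ EQ VH EH → Option ℕ∞) : Prop :=
  ∀ n m φ, C n m = some φ → m ∈ B n

variable {N : MarkingNet Q.toDirGraph ι} {H : TypedGraph TG VH EH} {Hp : Subgraph H.toDirGraph}
  {B : ι → Set (PMap VQ EQ VH EH)} {X : Set ℕ∞} {C C' : ι → PMap VQ EQ VH EH → Option ℕ∞}
  {n d l r : ι} {m m' : PMap VQ EQ VH EH} {φ ψ : ℕ∞} {a : PMap VQ EQ VH EH × ℕ∞}

theorem Bounds.ne_of_mem_deps (hB : N.Bounds H Hp B X) (hd : d ∈ N.deps n) : d ≠ n :=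
  fun e => hB.notMem_deps n (e ▸ hd)

theorem InBounds.of_dominated (hC' : InBounds B C') (h : ∀ k, Dominated (C k) (C' k)) :
    InBounds B C := by
  intro k m φ hφ
  obtain ⟨ψ, hψ, -⟩ := h k m φ hφ
  exact hC' k m ψ hψ

theorem mem_candidates_of_derived (hd : d ∈ N.deps n) (hφ : C d m = some φ)
    (ha : a ∈ N.derived H C n d m φ) : a ∈ N.candidates H Hp C n :=
  Or.inr ⟨d, hd, m, φ, hφ, ha⟩

theorem derived_mono (hle : φ ≤ ψ) (hC : ∀ k, Dominated (C k) (C' k))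
    (ha : a ∈ N.derived H C n d m φ) : Justified (N.derived H C' n d m ψ) a := by
  cases hk : N.kind n <;> simp only [Justified, derived, hk] at ha ⊢
  case vertexInput => exact ha.elim
  case union => cases ha; exact ⟨ψ, hle, rfl⟩
  case navigation =>
    obtain ⟨ha, hd, rfl⟩ := ha
    exact ⟨ψ, hle, ha, hd, rfl⟩
  case projection => cases ha; exact ⟨ψ, hle, rfl⟩
  case assignment x _ => cases ha; exact ⟨x, le_rfl, rfl⟩
  case filter =>
    obtain ⟨rfl, hx⟩ := ha
    exact ⟨ψ, hle, rfl, hx.trans_le hle⟩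
  case join =>
    obtain ⟨m', φ', hφ', hcomp, rfl⟩ := ha
    obtain ⟨ψ', hψ', hle'⟩ := hC _ _ _ hφ'
    exact ⟨max ψ ψ', max_le_max hle hle', m', ψ', hψ', hcomp, rfl⟩

theorem candidates_mono (hC : ∀ k, Dominated (C k) (C' k)) (ha : a ∈ N.candidates H Hp C n) :
    Justified (N.candidates H Hp C' n) a := by
  rcases ha with ha | ⟨d, hd, m, φ, hφ, ha⟩
  · exact ⟨a.2, le_rfl, Or.inl ha⟩
  · obtain ⟨ψ, hψ, hle⟩ := hC d m φ hφ
    obtain ⟨χ, hχ, hmem⟩ := derived_mono hle hC ha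
    exact ⟨χ, hχ, mem_candidates_of_derived hd hψ hmem⟩

/-! ### Joins seen from one of their dependencies -/

theorem Bounds.hasDomain (hB : N.Bounds H Hp B X) (hk : N.kind n = .join l r) :
    l ≠ r ∧ (∀ m ∈ B l, m.HasDomain (N.query l)) ∧ ∀ m ∈ B r, m.HasDomain (N.query r) := by
  have h := hB.closedAt n
  rw [ClosedAt, hk] at h
  exact ⟨h.1, h.2.1, h.2.2.1⟩

theorem Bounds.union_mem (hB : N.Bounds H Hp B X) (hk : N.kind n = .join l r) (hm : m ∈ B l)
    (hm' : m' ∈ B r)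
    (hcomp : m.restrict (N.query l ⊓ N.query r) = m'.restrict (N.query l ⊓ N.query r)) :
    m.union m' ∈ B n := by
  have h := hB.closedAt n
  rw [ClosedAt, hk] at h
  exact h.2.2.2 m hm m' hm' hcomp

theorem Bounds.otherDep_ne (hB : N.Bounds H Hp B X) (hk : N.kind n = .join l r)
    (hd : d ∈ N.deps n) : otherDep l r d ≠ d := by
  have hne := (hB.hasDomain hk).1
  simp only [deps, hk, Set.mem_insert_iff, Set.mem_singleton_iff] at hd
  rcases hd with rfl | rfl
  · rw [otherDep_left]; exact hne.symm
  · rw [otherDep_right hne]; exact hne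

theorem Bounds.union_mem_and_comm_and_restrict (hB : N.Bounds H Hp B X) (hk : N.kind n = .join l r)
    (hd : d ∈ N.deps n) (hm : m ∈ B d) (hm' : m' ∈ B (otherDep l r d))
    (hcomp : m'.restrict (N.query l ⊓ N.query r) = m.restrict (N.query l ⊓ N.query r)) :
    m.union m' ∈ B n ∧ m.union m' = m'.union m ∧ (m.union m').restrict (N.query d) = m ∧
      (m.union m').restrict (N.query (otherDep l r d)) = m' := by
  obtain ⟨hne, hl, hr⟩ := hB.hasDomain hk
  simp only [deps, hk, Set.mem_insert_iff, Set.mem_singleton_iff] at hd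
  rcases hd with rfl | rfl
  · rw [otherDep_left] at hm' ⊢
    exact ⟨hB.union_mem hk hm hm' hcomp.symm, PMap.union_comm (hl m hm) (hr m' hm') hcomp.symm,
      PMap.restrict_union_left (hl m hm),
      PMap.restrict_union_right (hl m hm) (hr m' hm') hcomp.symm⟩
  · rw [otherDep_right hne] at hm' ⊢
    have hcomm := PMap.union_comm (hl m' hm') (hr m hm) hcomp
    exact ⟨hcomm ▸ hB.union_mem hk hm' hm hcomp, hcomm.symm,
      PMap.restrict_union_left (hr m hm), hcomm ▸ PMap.restrict_union_left (hl m' hm')⟩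

theorem exists_derived_left (hB : N.Bounds H Hp B X) (hk : N.kind n = .join l r)
    (hC : InBounds B C) (hφ : C r m = some φ) (ha : a ∈ N.derived H C n r m φ) :
    ∃ m' φ', C l m' = some φ' ∧ a ∈ N.derived H C n l m' φ' := by
  have hne := (hB.hasDomain hk).1
  simp only [derived, hk, otherDep_left, otherDep_right hne] at ha ⊢
  obtain ⟨m', φ', hφ', hcomp, rfl⟩ := ha
  have hunion := hB.union_mem_and_comm_and_restrict hk (by simp [deps, hk]) (hC _ _ _ hφ)
    (by rw [otherDep_right hne]; exact hC _ _ _ hφ') hcomp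
  exact ⟨m', φ', hφ', m, φ, hφ, hcomp.symm, by rw [hunion.2.1, max_comm]⟩

theorem exists_derived_right (hB : N.Bounds H Hp B X) (hk : N.kind n = .join l r)
    (hC : InBounds B C) (hφ : C l m = some φ) (ha : a ∈ N.derived H C n l m φ) :
    ∃ m' φ', C r m' = some φ' ∧ a ∈ N.derived H C n r m' φ' := by
  have hne := (hB.hasDomain hk).1
  simp only [derived, hk, otherDep_left, otherDep_right hne] at ha ⊢
  obtain ⟨m', φ', hφ', hcomp, rfl⟩ := ha
  have hunion := hB.union_mem_and_comm_and_restrict hk (by simp [deps, hk]) (hC _ _ _ hφ)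
    (by rw [otherDep_left]; exact hC _ _ _ hφ') hcomp
  exact ⟨m', φ', hφ', m, φ, hφ, hcomp.symm, by rw [hunion.2.1, max_comm]⟩

theorem exists_derived_of_join (hB : N.Bounds H Hp B X) (hk : N.kind n = .join l r)
    (hd : d ∈ N.deps n) (hC : InBounds B C) (ha : a ∈ N.candidates H Hp C n) :
    ∃ m φ, C d m = some φ ∧ a ∈ N.derived H C n d m φ := by
  rcases ha with ⟨hk', -⟩ | ⟨d', hd', m, φ, hφ, ha⟩
  · simp [hk] at hk'
  · simp only [deps, hk, Set.mem_insert_iff, Set.mem_singleton_iff] at hd hd'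
    rcases hd with rfl | rfl <;> rcases hd' with rfl | rfl
    · exact ⟨m, φ, hφ, ha⟩
    · exact exists_derived_left hB hk hC hφ ha
    · exact exists_derived_right hB hk hC hφ ha
    · exact ⟨m, φ, hφ, ha⟩

/-! ### Target results as maximal candidates -/

theorem candidates_vertexInput (hk : N.kind n = .vertexInput) :
    N.candidates H Hp C n = {a | a.1 ∈ allMatches Q H (N.query n) Hp ∧ a.2 = ⊤} := by
  ext a; simp [candidates, deps, hk]

theorem candidates_union {D : Finset ι} (hk : N.kind n = .union D) :
    N.candidates H Hp C n = {a | ∃ d ∈ D, C d a.1 = some a.2} := by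
  ext ⟨m, φ⟩; simp [candidates, deps, derived, hk, -Prod.exists]

theorem candidates_navigation (hk : N.kind n = .navigation d) :
    N.candidates H Hp C n = {a | a.1 ∈ allMatches Q H (N.query n) ⊤ ∧
      C d (a.1.restrict (N.query d)) = some a.2} := by
  ext ⟨m, φ⟩; simp [candidates, deps, derived, hk, -Prod.exists, and_comm]

theorem candidates_projection (hk : N.kind n = .projection d) :
    N.candidates H Hp C n = {a | ∃ m, a.1 = m.restrict (N.query n) ∧ C d m = some a.2} := by
  ext ⟨m, φ⟩; simp [candidates, deps, derived, hk, and_comm]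

theorem candidates_assignment {x : ℕ∞} (hk : N.kind n = .assignment x d) :
    N.candidates H Hp C n = {a | (∃ φ, C d a.1 = some φ) ∧ a.2 = x} := by
  ext ⟨m, φ⟩; simp [candidates, deps, derived, hk, -Prod.exists]

theorem candidates_filter {x : ℕ∞} (hk : N.kind n = .filter x d) :
    N.candidates H Hp C n = {a | C d a.1 = some a.2 ∧ x < a.2} := by
  ext ⟨m, φ⟩; simp [candidates, deps, derived, hk, -Prod.exists]

theorem candidates_join (hB : N.Bounds H Hp B X) (hC : InBounds B C)
    (hk : N.kind n = .join l r) :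
    N.candidates H Hp C n = {a | ∃ ml φl mr φr, C l ml = some φl ∧ C r mr = some φr ∧
      ml.restrict (N.query l ⊓ N.query r) = mr.restrict (N.query l ⊓ N.query r) ∧
      a = (ml.union mr, max φl φr)} := by
  have hl : l ∈ N.deps n := by simp [deps, hk]
  ext a
  constructor
  · intro ha
    obtain ⟨ml, φl, hφl, hder⟩ := exists_derived_of_join hB hk hl hC ha
    simp only [derived, hk, otherDep_left] at hder
    obtain ⟨mr, φr, hφr, hcomp, rfl⟩ := hder
    exact ⟨ml, φl, mr, φr, hφl, hφr, hcomp.symm, rfl⟩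
  · rintro ⟨ml, φl, mr, φr, hφl, hφr, hcomp, rfl⟩
    refine mem_candidates_of_derived hl hφl ?_
    simp only [derived, hk, otherDep_left]
    exact ⟨mr, φr, hφr, hcomp.symm, rfl⟩

theorem candidates_join_unique (hB : N.Bounds H Hp B X) (hC : InBounds B C)
    (hk : N.kind n = .join l r) (hφ : (m, φ) ∈ N.candidates H Hp C n)
    (hψ : (m, ψ) ∈ N.candidates H Hp C n) : φ = ψ := by
  obtain ⟨-, hl, hr⟩ := hB.hasDomain hk
  have key {φ : ℕ∞} (hφ : (m, φ) ∈ N.candidates H Hp C n) :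
      ∃ φl φr, C l (m.restrict (N.query l)) = some φl ∧ C r (m.restrict (N.query r)) = some φr ∧
        φ = max φl φr := by
    rw [candidates_join hB hC hk] at hφ
    obtain ⟨ml, φl, mr, φr, hφl, hφr, hcomp, e⟩ := hφ
    obtain ⟨rfl, rfl⟩ := Prod.mk.inj e
    have hml := hl _ (hC _ _ _ hφl)
    have hmr := hr _ (hC _ _ _ hφr)
    exact ⟨φl, φr, by rwa [PMap.restrict_union_left hml],
      by rwa [PMap.restrict_union_right hml hmr hcomp], rfl⟩
  obtain ⟨φl, φr, hφl, hφr, rfl⟩ := key hφ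
  obtain ⟨ψl, ψr, hψl, hψr, rfl⟩ := key hψ
  rw [Option.some.inj (hφl.symm.trans hψl), Option.some.inj (hφr.symm.trans hψr)]

theorem results_eq_candidates (hB : N.Bounds H Hp B X) (hC : InBounds B C) (n : ι) :
    N.results H Hp (fun k => {a | C k a.1 = some a.2}) n =
      {a | IsGreatest {φ | (a.1, φ) ∈ N.candidates H Hp C n} a.2} := by
  cases hk : N.kind n
  case vertexInput =>
    rw [setOf_isGreatest_eq_self] <;> rw [candidates_vertexInput hk]
    · simp only [results, hk]
    · exact fun m φ ψ hφ hψ => hφ.2.trans hψ.2.symm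
  case union =>
    rw [candidates_union hk]
    simp only [results, hk, Set.mem_ofPred_eq]
  case navigation d =>
    rw [candidates_navigation hk]
    simp only [results, hk, Set.mem_ofPred_eq]
    ext a
    exact ⟨fun ⟨ha, hφ, hmax⟩ => ⟨⟨ha, hφ⟩, fun ψ hψ => hmax hψ.2⟩,
      fun ⟨⟨ha, hφ⟩, hmax⟩ => ⟨ha, hφ, fun ψ hψ => hmax ⟨ha, hψ⟩⟩⟩
  case projection d =>
    rw [candidates_projection hk]
    simp only [results, hk, Set.mem_ofPred_eq]
    ext ⟨m, φ⟩
    constructor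
    · rintro ⟨m', rfl, hφ, hmax⟩
      exact ⟨⟨m', rfl, hφ⟩, fun ψ ⟨m'', e, hψ⟩ => hmax.2 ⟨m'', hψ, e.symm⟩⟩
    · rintro ⟨⟨m', rfl, hφ⟩, hmax⟩
      exact ⟨m', rfl, hφ, ⟨m', hφ, rfl⟩, fun ψ ⟨m'', hψ, e⟩ => hmax ⟨m'', e.symm, hψ⟩⟩
  case assignment =>
    rw [setOf_isGreatest_eq_self] <;> rw [candidates_assignment hk]
    · simp only [results, hk, Set.mem_ofPred_eq]
    · exact fun m φ ψ hφ hψ => hφ.2.trans hψ.2.symm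
  case filter =>
    rw [setOf_isGreatest_eq_self] <;> rw [candidates_filter hk]
    · simp only [results, hk, Set.mem_ofPred_eq]
    · exact fun m φ ψ hφ hψ => Option.some.inj (hφ.1.symm.trans hψ.1)
  case join l r =>
    rw [setOf_isGreatest_eq_self fun _ _ _ => candidates_join_unique hB hC hk,
      candidates_join hB hC hk]
    ext a
    simp only [results, hk, Set.mem_ofPred_eq, Prod.exists, exists_and_left]

end MarkingNet

section Enumerate

variable {α : Type*} [Finite α] {S : Set α}

theorem mem_enumerate {a : α} : a ∈ enumerate S ↔ a ∈ S := by simp [enumerate]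

theorem nodup_enumerate (S : Set α) : (enumerate S).Nodup := Finset.nodup_toList _

/-- The sum of `f` over a set of matches. -/
noncomputable def matchSum (S : Set α) (f : α → ℕ) : ℕ := ∑ m ∈ S.toFinite.toFinset, f m

theorem matchSum_mono {T : Set α} {f g : α → ℕ} (hST : S ⊆ T) (hfg : ∀ m ∈ S, f m ≤ g m) :
    matchSum S f ≤ matchSum T g :=
  (Finset.sum_le_sum fun m hm => hfg m (by simpa using hm)).trans
    (Finset.sum_le_sum_of_subset (by simpa using hST))

theorem list_sum_le_matchSum {L : List α} (hL : L.Nodup) (hS : ∀ m ∈ L, m ∈ S) (f : α → ℕ) :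
    (L.map f).sum ≤ matchSum S f := by
  classical
  rw [← List.sum_toFinset f hL]
  exact Finset.sum_le_sum_of_subset fun m hm => by simpa using hS m (by simpa using hm)

end Enumerate

theorem Memory.mem_stored {ι M : Type*} {s : Memory ι M} {n : ι} {m : M} :
    m ∈ s.stored n ↔ ∃ φ, s.marking n m = some φ := Option.isSome_iff_exists

/-! ### Handling a single change -/

namespace MarkingNet

variable {TV TE VQ EQ VH EH ι : Type*} {TG : DirGraph TV TE} {Q : TypedGraph TG VQ EQ}
  {N : MarkingNet Q.toDirGraph ι} {H : TypedGraph TG VH EH} {Hp : Subgraph H.toDirGraph}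
  {B : ι → Set (PMap VQ EQ VH EH)} {X : Set ℕ∞} {C C' : ι → PMap VQ EQ VH EH → Option ℕ∞}
  {n d l r : ι} {m m' : PMap VQ EQ VH EH} {φ ψ : ℕ∞} {a : PMap VQ EQ VH EH × ℕ∞}
  {s : Memory ι (PMap VQ EQ VH EH)} {c : Change (PMap VQ EQ VH EH)}

/-- The results of `n` that may be written when a change of the match `m` of `d` is handled. -/
def scope (N : MarkingNet Q.toDirGraph ι) (B : ι → Set (PMap VQ EQ VH EH)) (n d : ι)
    (m : PMap VQ EQ VH EH) : Set (PMap VQ EQ VH EH) :=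
  match N.kind n with
  | .vertexInput => ∅
  | .union _ => {m}
  | .navigation _ => {m' | m' ∈ B n ∧ m'.restrict (N.query d) = m}
  | .projection _ => {m.restrict (N.query n)}
  | .assignment _ _ => {m}
  | .filter _ _ => {m}
  | .join _ _ => {m' | m' ∈ B n ∧ m'.restrict (N.query d) = m}

theorem scope_subset (hB : N.Bounds H Hp B X) (hd : d ∈ N.deps n) (hm : m ∈ B d) :
    N.scope B n d m ⊆ B n := by
  intro m' hm'
  have hclosed := hB.closedAt n
  cases hk : N.kind n <;> simp only [deps, scope, ClosedAt, hk] at hclosed hd hm'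
  case vertexInput => exact hd.elim
  case union => rw [hm']; exact hclosed d hd hm
  case navigation => exact hm'.1
  case projection => cases hd; rw [hm']; exact hclosed m hm
  case assignment => cases hd; rw [hm']; exact hclosed.1 hm
  case filter => cases hd; rw [hm']; exact hclosed hm
  case join => exact hm'.1

theorem mem_scope_of_derived (hB : N.Bounds H Hp B X) (hC : InBounds B C) (hd : d ∈ N.deps n)
    (hm : m ∈ B d) (ha : a ∈ N.derived H C n d m φ) : a.1 ∈ N.scope B n d m := by
  have hclosed := hB.closedAt n
  cases hk : N.kind n <;> simp only [derived, scope, ClosedAt, hk] at hclosed ha ⊢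
  case vertexInput => exact ha.elim
  case union => cases ha; rfl
  case navigation => exact ⟨hclosed ha.1, ha.2.1⟩
  case projection => cases ha; rfl
  case assignment => cases ha; rfl
  case filter => cases ha.1; rfl
  case join =>
    obtain ⟨m', φ', hφ', hcomp, rfl⟩ := ha
    have hunion := hB.union_mem_and_comm_and_restrict hk hd hm (hC _ _ _ hφ') hcomp
    exact ⟨hunion.1, hunion.2.2.1⟩

theorem snd_mem_of_derived (hB : N.Bounds H Hp B X) (hC : ∀ k m φ, C k m = some φ → φ ∈ X)
    (hφ : φ ∈ X) (ha : a ∈ N.derived H C n d m φ) : a.2 ∈ X := by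
  have hclosed := hB.closedAt n
  cases hk : N.kind n <;> simp only [derived, ClosedAt, hk] at hclosed ha
  case vertexInput => exact ha.elim
  case union => cases ha; exact hφ
  case navigation => rwa [ha.2.2]
  case projection => cases ha; exact hφ
  case assignment => cases ha; exact hclosed.2
  case filter => cases ha.1; exact hφ
  case join =>
    obtain ⟨m', φ', hφ', -, rfl⟩ := ha
    rcases max_choice φ φ' with e | e <;> simp only [e]
    · exact hφ
    · exact hC _ _ _ hφ'

theorem derived_congr (hjoin : ∀ l r, N.kind n ≠ .join l r) :
    N.derived H C n d m φ = N.derived H C' n d m φ := by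
  cases hk : N.kind n <;> simp only [derived, hk]
  case join l r => exact absurd hk (hjoin l r)

open Classical in
theorem derived_update (hB : N.Bounds H Hp B X) (hd : d ∈ N.deps n)
    (f : PMap VQ EQ VH EH → Option ℕ∞) :
    N.derived H (Function.update C d f) n d m φ = N.derived H C n d m φ := by
  cases hk : N.kind n
  case join l r => simp only [derived, hk, Function.update_of_ne (hB.otherDep_ne hk hd)]
  all_goals exact derived_congr (by simp [hk])

open Classical in
theorem candidates_update (hB : N.Bounds H Hp B X) (hd : d ∈ N.deps n)
    (hC : InBounds B (Function.update C d (Function.update (C d) m (some φ))))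
    (ha : a ∈ N.candidates H Hp (Function.update C d (Function.update (C d) m (some φ))) n) :
    a ∈ N.candidates H Hp C n ∨ a ∈ N.derived H C n d m φ := by
  have of_derived {m' φ'} (hφ' : Function.update (C d) m (some φ) m' = some φ')
      (ha : a ∈ N.derived H C n d m' φ') :
      a ∈ N.candidates H Hp C n ∨ a ∈ N.derived H C n d m φ := by
    by_cases hm : m' = m
    · subst hm
      obtain rfl : φ = φ' := by simpa using hφ'
      exact Or.inr ha
    · exact Or.inl (mem_candidates_of_derived hd (by simpa [hm] using hφ') ha)
  by_cases hjoin : ∃ l r, N.kind n = .join l r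
  · obtain ⟨l, r, hk⟩ := hjoin
    obtain ⟨m', φ', hφ', ha⟩ := exists_derived_of_join hB hk hd hC ha
    exact of_derived (by simpa using hφ') (derived_update hB hd _ ▸ ha)
  · rcases ha with ha | ⟨d', hd', m', φ', hφ', ha⟩
    · exact Or.inl (Or.inl ha)
    · rw [derived_congr (C' := C) fun l r hk => hjoin ⟨l, r, hk⟩] at ha
      by_cases hdd : d' = d
      · subst hdd
        exact of_derived (by simpa using hφ') ha
      · exact Or.inl (mem_candidates_of_derived hd' (by simpa [hdd] using hφ') ha)

/-- The node `n` extends the matches of its dependencies: it is a navigation node or a join. -/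
def Extending (N : MarkingNet Q.toDirGraph ι) (n : ι) : Prop :=
  (∃ d, N.kind n = .navigation d) ∨ ∃ l r, N.kind n = .join l r

theorem Extending.exists_derived (hn : N.Extending n) (hB : N.Bounds H Hp B X)
    (hC : InBounds B C) (hd : d ∈ N.deps n) (ha : a ∈ N.candidates H Hp C n) :
    ∃ m φ, C d m = some φ ∧ a ∈ N.derived H C n d m φ := by
  rcases hn with ⟨k, hk⟩ | ⟨l, r, hk⟩
  · rcases ha with ⟨hk', -⟩ | ⟨d', hd', h⟩
    · simp [hk] at hk'
    · simp only [deps, hk, Set.mem_singleton_iff] at hd hd'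
      exact hd ▸ hd' ▸ h
  · exact exists_derived_of_join hB hk hd hC ha

theorem Extending.restrict_of_derived (hn : N.Extending n) (hB : N.Bounds H Hp B X)
    (hC : InBounds B C) (hd : d ∈ N.deps n) (hm : m ∈ B d) (ha : a ∈ N.derived H C n d m φ) :
    a.1.restrict (N.query d) = m ∧ φ ≤ a.2 := by
  rcases hn with ⟨k, hk⟩ | ⟨l, r, hk⟩ <;> simp only [derived, hk] at ha
  · exact ⟨ha.2.1, ha.2.2.ge⟩
  · obtain ⟨m', φ', hφ', hcomp, rfl⟩ := ha
    have hunion := hB.union_mem_and_comm_and_restrict hk hd hm (hC _ _ _ hφ') hcomp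
    exact ⟨hunion.2.2.1, le_max_left _ _⟩

theorem Extending.exists_derived_of_value (hn : N.Extending n) (ha : a ∈ N.derived H C n d m φ)
    (ψ : ℕ∞) : ∃ χ, (a.1, χ) ∈ N.derived H C n d m ψ ∧ a.2 ≤ max χ φ := by
  rcases hn with ⟨k, hk⟩ | ⟨l, r, hk⟩ <;> simp only [derived, hk] at ha ⊢
  · exact ⟨ψ, ⟨ha.1, ha.2.1, rfl⟩, ha.2.2 ▸ le_max_right _ _⟩
  · obtain ⟨m', φ', hφ', hcomp, rfl⟩ := ha
    exact ⟨max ψ φ', ⟨m', φ', hφ', hcomp, rfl⟩,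
      max_le (le_max_right _ _) ((le_max_right _ _).trans (le_max_left _ _))⟩

variable [Finite VQ] [Finite EQ] [Finite VH] [Finite EH]

theorem mem_newResults : a ∈ N.newResults H s n d m φ ↔ a ∈ N.derived H s.marking n d m φ := by
  cases hk : N.kind n <;> simp only [newResults, derived, hk]
  case vertexInput => simp
  case union => simp
  case navigation =>
    obtain ⟨m', φ'⟩ := a
    simp only [List.mem_map, mem_enumerate, Set.mem_ofPred_eq, Prod.mk.injEq]
    exact ⟨by rintro ⟨m', h, rfl, rfl⟩; exact ⟨h.1, h.2, rfl⟩,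
      fun ⟨h, hd, e⟩ => ⟨m', ⟨h, hd⟩, rfl, e.symm⟩⟩
  case projection => simp
  case assignment => simp
  case filter x _ => by_cases hx : x < φ <;> simp [hx]
  case join l r =>
    simp only [List.mem_map, mem_enumerate, Set.mem_ofPred_eq]
    change (∃ m', (m' ∈ s.stored (otherDep l r d) ∧ _) ∧
      (m.union m', max φ ((s.marking (otherDep l r d) m').getD 0)) = a) ↔ _
    simp only [Memory.mem_stored]
    constructor
    · rintro ⟨m', ⟨⟨φ', hφ'⟩, hcomp⟩, rfl⟩
      exact ⟨m', φ', hφ', hcomp, by rw [hφ', Option.getD_some]⟩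
    · rintro ⟨m', φ', hφ', hcomp, rfl⟩
      exact ⟨m', ⟨⟨φ', hφ'⟩, hcomp⟩, by rw [hφ', Option.getD_some]⟩

theorem nodup_newResults (hB : N.Bounds H Hp B X) (hs : InBounds B s.marking)
    (hd : d ∈ N.deps n) (hm : m ∈ B d) :
    ((N.newResults H s n d m φ).map Prod.fst).Nodup := by
  cases hk : N.kind n <;> simp only [newResults, hk]
  case filter => split_ifs <;> simp
  case navigation => simpa [Function.comp_def] using nodup_enumerate _
  case join l r =>
    rw [List.map_map]
    refine (nodup_enumerate _).map_on fun m₁ h₁ m₂ h₂ e => ?_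
    obtain ⟨hstored₁, hcomp₁⟩ := mem_enumerate.1 h₁
    obtain ⟨hstored₂, hcomp₂⟩ := mem_enumerate.1 h₂
    obtain ⟨φ₁, hφ₁⟩ := Memory.mem_stored.1 hstored₁
    obtain ⟨φ₂, hφ₂⟩ := Memory.mem_stored.1 hstored₂
    rw [← (hB.union_mem_and_comm_and_restrict hk hd hm (hs _ _ _ hφ₁) hcomp₁).2.2.2,
      ← (hB.union_mem_and_comm_and_restrict hk hd hm (hs _ _ _ hφ₂) hcomp₂).2.2.2]
    exact congrArg (PMap.restrict · _) e
  all_goals simp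

theorem Extending.mem_associatedResults (hn : N.Extending n) :
    m' ∈ N.associatedResults s n d m φ ↔ m' ∈ s.stored n ∧ m'.restrict (N.query d) = m := by
  rcases hn with ⟨k, hk⟩ | ⟨l, r, hk⟩ <;> simp only [associatedResults, hk, mem_enumerate] <;> rfl

theorem derived_of_mem_associatedResults (hn : ¬ N.Extending n)
    (hm' : m' ∈ N.associatedResults s n d m φ) : (m', φ) ∈ N.derived H C n d m φ := by
  cases hk : N.kind n <;> simp only [associatedResults, derived, hk] at hm' ⊢
  case navigation k => exact absurd (Or.inl ⟨k, hk⟩) hn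
  case join l r => exact absurd (Or.inr ⟨l, r, hk⟩) hn
  case filter => split_ifs at hm' with hx <;> simp_all
  all_goals simp_all

theorem mem_associatedResults_or_derived (hn : ¬ N.Extending n)
    (ha : a ∈ N.derived H C n d m φ) (ψ : ℕ∞) :
    a.1 ∈ N.associatedResults s n d m φ ∧ a.2 = φ ∨ a ∈ N.derived H C n d m ψ := by
  cases hk : N.kind n <;> simp only [associatedResults, derived, hk] at ha ⊢
  case navigation k => exact absurd (Or.inl ⟨k, hk⟩) hn
  case join l r => exact absurd (Or.inr ⟨l, r, hk⟩) hn
  all_goals simp_all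

theorem nodup_associatedResults : (N.associatedResults s n d m φ).Nodup := by
  cases hk : N.kind n <;> simp only [associatedResults, hk]
  case filter => split_ifs <;> simp
  case navigation => exact nodup_enumerate _
  case join => exact nodup_enumerate _
  all_goals simp

/-- The marked matches that node `n` writes when it handles the change `c` of `d`. -/
noncomputable def offers (N : MarkingNet Q.toDirGraph ι) (H : TypedGraph TG VH EH)
    (s : Memory ι (PMap VQ EQ VH EH)) (n d : ι) :
    Change (PMap VQ EQ VH EH) → List (PMap VQ EQ VH EH × ℕ∞)
  | .added m φ => N.newResults H s n d m φ
  | .raised m φ => (N.associatedResults s n d m φ).map fun m' => (m', φ)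

theorem mem_scope_of_mem_offers (hB : N.Bounds H Hp B X) (hs : InBounds B s.marking)
    (hd : d ∈ N.deps n) (hc : c.item ∈ B d) (ha : a ∈ N.offers H s n d c) :
    a.1 ∈ N.scope B n d c.item := by
  cases c with
  | added m φ => exact mem_scope_of_derived hB hs hd hc (mem_newResults.1 ha)
  | raised m φ =>
    obtain ⟨m', hm', rfl⟩ := List.mem_map.1 ha
    by_cases hn : N.Extending n
    · obtain ⟨hstored, hrestrict⟩ := hn.mem_associatedResults.1 hm'
      obtain ⟨ψ, hψ⟩ := Memory.mem_stored.1 hstored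
      rcases hn with ⟨k, hk⟩ | ⟨l, r, hk⟩ <;> simp only [scope, hk] <;>
        exact ⟨hs _ _ _ hψ, hrestrict⟩
    · exact mem_scope_of_derived (H := H) hB hs hd hc (derived_of_mem_associatedResults hn hm')

theorem snd_mem_of_mem_offers (hB : N.Bounds H Hp B X)
    (hX : ∀ k m φ, s.marking k m = some φ → φ ∈ X) (hc : c.value ∈ X)
    (ha : a ∈ N.offers H s n d c) : a.2 ∈ X := by
  cases c with
  | added m φ => exact snd_mem_of_derived hB hX hc (mem_newResults.1 ha)
  | raised m φ =>
    obtain ⟨m', -, rfl⟩ := List.mem_map.1 ha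
    exact hc

theorem nodup_offers (hB : N.Bounds H Hp B X) (hs : InBounds B s.marking) (hd : d ∈ N.deps n)
    (hc : c.item ∈ B d) : ((N.offers H s n d c).map Prod.fst).Nodup := by
  cases c with
  | added m φ => exact nodup_newResults hB hs hd hc
  | raised m φ => simpa [offers, Function.comp_def] using nodup_associatedResults

theorem justified_of_mem_offers (hB : N.Bounds H Hp B X) (hs : InBounds B s.marking)
    (hd : d ∈ N.deps n)
    (hsound : ∀ m ψ, s.marking n m = some ψ → Justified (N.candidates H Hp s.marking n) (m, ψ))
    (hc : Covers (s.marking d) (c.item, c.value)) (ha : a ∈ N.offers H s n d c) :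
    Justified (N.candidates H Hp s.marking n) a := by
  obtain ⟨χ, hχ, hle⟩ := hc
  have of_derived {φ} (hφ : φ ≤ χ) (ha : a ∈ N.derived H s.marking n d c.item φ) :
      Justified (N.candidates H Hp s.marking n) a := by
    obtain ⟨ψ, hψ, hmem⟩ := derived_mono hφ (fun _ => .refl _) ha
    exact ⟨ψ, hψ, mem_candidates_of_derived hd hχ hmem⟩
  cases c with
  | added m φ => exact of_derived hle (mem_newResults.1 ha)
  | raised m φ =>
    obtain ⟨m', hm', rfl⟩ := List.mem_map.1 ha
    by_cases hn : N.Extending n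
    · obtain ⟨hstored, rfl⟩ := hn.mem_associatedResults.1 hm'
      obtain ⟨ψ, hψ⟩ := Memory.mem_stored.1 hstored
      obtain ⟨φ', -, hmem⟩ := hsound m' ψ hψ
      obtain ⟨m₁, χ₁, hχ₁, hder⟩ := hn.exists_derived hB hs hd hmem
      obtain ⟨rfl, hle'⟩ := hn.restrict_of_derived hB hs hd (hs _ _ _ hχ₁) hder
      obtain rfl : χ = χ₁ := Option.some.inj (hχ.symm.trans hχ₁)
      exact ⟨φ', hle.trans hle', hmem⟩
    · exact of_derived hle (derived_of_mem_associatedResults hn hm')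

theorem covers_of_derived (hB : N.Bounds H Hp B X) (hs : InBounds B s.marking)
    (hd : d ∈ N.deps n) (hC : ∀ k, Dominated (C k) (s.marking k)) (hfits : c.Fits (C d))
    (hcov : ∀ a ∈ N.candidates H Hp C n, Covers (s.marking n) a)
    {f : PMap VQ EQ VH EH → Option ℕ∞} (hf : Dominated (s.marking n) f)
    (hoffers : ∀ a ∈ N.offers H s n d c, Covers f a)
    (ha : a ∈ N.derived H C n d c.item c.value) : Covers f a := by
  cases c with
  | added m φ =>
    obtain ⟨ψ, hle, hψ⟩ := derived_mono le_rfl hC ha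
    exact (hoffers _ (mem_newResults.2 hψ)).of_le hle
  | raised m φ =>
    obtain ⟨ψ, hψ, -⟩ := hfits
    by_cases hn : N.Extending n
    · obtain ⟨χ, hχ, hle⟩ := hn.exists_derived_of_value ha ψ
      have hold : Covers (s.marking n) (a.1, χ) := hcov _ (mem_candidates_of_derived hd hψ hχ)
      have hstored : a.1 ∈ s.stored n := Memory.mem_stored.2 (hold.imp fun _ h => h.1)
      have hCB : InBounds B C := hs.of_dominated hC
      have hrestrict := (hn.restrict_of_derived hB hCB hd (hCB _ _ _ hψ) hχ).1
      have hnew : Covers f (a.1, φ) :=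
        hoffers _ (List.mem_map_of_mem (hn.mem_associatedResults.2 ⟨hstored, hrestrict⟩))
      exact ((hold.mono hf).max hnew).of_le hle
    · rcases mem_associatedResults_or_derived (s := s) hn ha ψ with ⟨ha, e⟩ | ha
      · obtain ⟨m', φ'⟩ := a
        obtain rfl : φ' = φ := e
        exact hoffers _ (List.mem_map_of_mem ha)
      · exact (hcov _ (mem_candidates_of_derived hd hψ ha)).mono hf

end MarkingNet

namespace MarkingNet

/-! ### The invariant of the procedure -/

variable {TV TE VQ EQ VH EH ι : Type*} {TG : DirGraph TV TE} {Q : TypedGraph TG VQ EQ}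
  {N : MarkingNet Q.toDirGraph ι} {H : TypedGraph TG VH EH} {Hp : Subgraph H.toDirGraph}
  {B : ι → Set (PMap VQ EQ VH EH)} {X : Set ℕ∞} {V : ι → ι → PMap VQ EQ VH EH → Option ℕ∞}
  {n d : ι} {s : Memory ι (PMap VQ EQ VH EH)} {c : Change (PMap VQ EQ VH EH)}
  {L P : List (Change (PMap VQ EQ VH EH))}

/-- The invariant of the procedure, where `V n d` are the markings of the matches of `d` according
to the changes that `n` has handled. It says nothing about the order in which nodes are executed:
the result set of a node is complete for what the node has seen of its dependencies, and sound for
their current result sets. -/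
structure Invariant (N : MarkingNet Q.toDirGraph ι) (H : TypedGraph TG VH EH)
    (Hp : Subgraph H.toDirGraph) (B : ι → Set (PMap VQ EQ VH EH)) (X : Set ℕ∞)
    (V : ι → ι → PMap VQ EQ VH EH → Option ℕ∞) (s : Memory ι (PMap VQ EQ VH EH)) : Prop where
  logs : s.LogsValid
  inBounds : InBounds B s.marking
  log_values : ∀ d, ∀ c ∈ s.changes d, c.value ∈ X
  sound : ∀ n m φ, s.marking n m = some φ → Justified (N.candidates H Hp s.marking n) (m, φ)
  view_dominated : ∀ n d, Dominated (V n d) (s.marking d)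
  complete : ∀ n, (N.kind n = .vertexInput → s.loaded n = true) →
    ∀ a ∈ N.candidates H Hp (V n) n, Covers (s.marking n) a

namespace Invariant

theorem values (h : N.Invariant H Hp B X V s) (n : ι) (m : PMap VQ EQ VH EH) (φ : ℕ∞)
    (hφ : s.marking n m = some φ) : φ ∈ X := by
  obtain ⟨c, hc, -, rfl⟩ := Memory.exists_change_of_marking h.logs hφ
  exact h.log_values n c hc

theorem tick (h : N.Invariant H Hp B X V s) (k : ℕ) : N.Invariant H Hp B X V (s.tick k) :=
  ⟨h.1, h.2, h.3, h.4, h.5, h.6⟩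

theorem writeAll (h : N.Invariant H Hp B X V s) {L : List (PMap VQ EQ VH EH × ℕ∞)}
    (hbounds : ∀ a ∈ L, a.1 ∈ B n) (hvalues : ∀ a ∈ L, a.2 ∈ X)
    (hsound : ∀ a ∈ L, Justified (N.candidates H Hp s.marking n) a) :
    N.Invariant H Hp B X V (s.writeAll n L) := by
  have hg := Memory.grows_writeAll n L s
  have hlogs := h.logs.writeAll n L
  have mem_or_mem {k : ι} {c : Change (PMap VQ EQ VH EH)}
      (hc : c ∈ (s.writeAll n L).changes k) :
      c ∈ s.changes k ∨ k = n ∧ (c.item, c.value) ∈ L := by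
    by_cases hk : k = n
    · exact (Memory.mem_changes_writeAll (hk ▸ hc)).imp (hk ▸ ·) fun h => ⟨hk, h⟩
    · exact Or.inl (hg.changes_of_ne k hk ▸ hc)
  have justified {k : ι} {m : PMap VQ EQ VH EH} {φ : ℕ∞}
      (hφ : (s.writeAll n L).marking k m = some φ) :
      m ∈ B k ∧ Justified (N.candidates H Hp s.marking k) (m, φ) := by
    obtain ⟨c, hchange, rfl, rfl⟩ := Memory.exists_change_of_marking hlogs hφ
    rcases mem_or_mem hchange with hc | ⟨rfl, hc⟩
    · obtain ⟨L', L'', hL⟩ := List.append_of_mem hc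
      obtain ⟨ψ, hψ, hle⟩ := h.logs.covers (d := k) (c := c) (L := L') ⟨L'', by simp [hL]⟩
      obtain ⟨χ, hle', hmem⟩ := h.sound _ _ _ hψ
      exact ⟨h.inBounds _ _ _ hψ, χ, hle.trans hle', hmem⟩
    · exact ⟨hbounds _ hc, hsound _ hc⟩
  refine ⟨hlogs, fun k m φ hφ => (justified hφ).1, fun k c hc => ?_, fun k m φ hφ => ?_,
    fun k d => (h.view_dominated k d).trans (hg.dominated d),
    fun k hk a ha => (h.complete k (by rwa [hg.loaded] at hk) a ha).mono (hg.dominated k)⟩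
  · rcases mem_or_mem hc with hc | ⟨-, hc⟩
    · exact h.log_values k c hc
    · exact hvalues _ hc
  · exact (justified hφ).2.of_forall fun b hb => candidates_mono hg.dominated hb

open Classical in
theorem update_view (h : N.Invariant H Hp B X V s) {f : PMap VQ EQ VH EH → Option ℕ∞}
    (hf : Dominated f (s.marking d))
    (hcov : ∀ a ∈ N.candidates H Hp (Function.update (V n) d f) n, Covers (s.marking n) a) :
    N.Invariant H Hp B X (Function.update V n (Function.update (V n) d f)) s := by
  refine ⟨h.logs, h.inBounds, h.log_values, h.sound, fun k e => ?_, fun k hk => ?_⟩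
  · by_cases hk : k = n
    · subst hk
      by_cases he : e = d
      · subst he; simpa using hf
      · simpa [he] using h.view_dominated k e
    · simpa [hk] using h.view_dominated k e
  · by_cases hkn : k = n
    · subst hkn; simpa using hcov
    · simpa [hkn] using h.complete k hk

theorem item_mem (h : N.Invariant H Hp B X V s) (hp : L ++ [c] <+: s.changes d) : c.item ∈ B d := by
  obtain ⟨φ, hφ, -⟩ := h.logs.covers hp
  exact h.inBounds _ _ _ hφ

end Invariant

theorem offerAll_eq (n : ι) (L : List (PMap VQ EQ VH EH × ℕ∞)) (s : Memory ι (PMap VQ EQ VH EH)) :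
    offerAll n L s = (s.writeAll n L).tick (L.map fun a => a.1.size + 1).sum := by
  induction L generalizing s with
  | nil => rfl
  | cons a L ih =>
    change offerAll n L ((s.tick (a.1.size + 1)).write n a.1 a.2) = _
    rw [ih, Memory.write_tick, Memory.writeAll_tick, Memory.tick_tick, Memory.writeAll_cons,
      List.map_cons, List.sum_cons]

theorem raiseAll_eq (n : ι) (L : List (PMap VQ EQ VH EH)) (φ : ℕ∞)
    (s : Memory ι (PMap VQ EQ VH EH)) :
    raiseAll n L φ s = (s.writeAll n (L.map fun m => (m, φ))).tick L.length := by
  induction L generalizing s with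
  | nil => rfl
  | cons m L ih =>
    change raiseAll n L φ ((s.tick 1).write n m φ) = _
    rw [ih, Memory.write_tick, Memory.writeAll_tick, Memory.tick_tick, List.map_cons,
      Memory.writeAll_cons, List.length_cons, Nat.add_comm 1]

variable [Finite VQ] [Finite EQ] [Finite VH] [Finite EH]

/-- An upper bound for the number of steps that `n` needs to handle the change `c` of `d`, in any
state. -/
noncomputable def cost (N : MarkingNet Q.toDirGraph ι) (B : ι → Set (PMap VQ EQ VH EH)) (n d : ι) :
    Change (PMap VQ EQ VH EH) → ℕ
  | .added m _ => m.size + matchSum (N.scope B n d m) fun m' => m'.size + 1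
  | .raised m _ => 1 + matchSum (N.scope B n d m) fun _ => 1

theorem exists_handleChange_eq (hB : N.Bounds H Hp B X) (hs : InBounds B s.marking)
    (hd : d ∈ N.deps n) (hc : c.item ∈ B d) :
    ∃ k ≤ N.cost B n d c,
      N.handleChange H n d s c = (s.writeAll n (N.offers H s n d c)).tick k := by
  have sum_le (f : PMap VQ EQ VH EH → ℕ) :
      (((N.offers H s n d c).map Prod.fst).map f).sum ≤ matchSum (N.scope B n d c.item) f := by
    refine list_sum_le_matchSum (nodup_offers hB hs hd hc) (fun m hm => ?_) f
    obtain ⟨a, ha, rfl⟩ := List.mem_map.1 hm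
    exact mem_scope_of_mem_offers hB hs hd hc ha
  cases c with
  | added m φ =>
    refine ⟨_, Nat.add_le_add_left (sum_le fun m' => m'.size + 1) m.size, ?_⟩
    rw [handleChange, offerAll_eq, Memory.writeAll_tick, Memory.tick_tick, List.map_map]
    rfl
  | raised m φ =>
    refine ⟨_, Nat.add_le_add_left (sum_le fun _ => 1) 1, ?_⟩
    rw [handleChange, raiseAll_eq, Memory.writeAll_tick, Memory.tick_tick]
    simp [offers, Function.comp_def]

theorem grows_handleChange (hB : N.Bounds H Hp B X) (hs : InBounds B s.marking)
    (hd : d ∈ N.deps n) (hc : c.item ∈ B d) : Memory.Grows n s (N.handleChange H n d s c) := by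
  obtain ⟨k, -, e⟩ := exists_handleChange_eq (H := H) hB hs hd hc
  exact e ▸ (Memory.grows_writeAll n _ s).tick k

theorem steps_handleChange_le (hB : N.Bounds H Hp B X) (hs : InBounds B s.marking)
    (hd : d ∈ N.deps n) (hc : c.item ∈ B d) :
    (N.handleChange H n d s c).steps ≤ s.steps + N.cost B n d c := by
  obtain ⟨k, hk, e⟩ := exists_handleChange_eq (H := H) hB hs hd hc
  rw [e, Memory.tick, Memory.steps_writeAll]
  exact Nat.add_le_add_left hk _

namespace Invariant

open Classical in
theorem handleChange (h : N.Invariant H Hp B X V s) (hB : N.Bounds H Hp B X) (hd : d ∈ N.deps n)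
    (hp : L ++ [c] <+: s.changes d) (hV : V n d = replay L) :
    N.Invariant H Hp B X (Function.update V n (Function.update (V n) d (replay (L ++ [c]))))
      (N.handleChange H n d s c) := by
  obtain ⟨k, -, e⟩ := exists_handleChange_eq (H := H) hB h.inBounds hd (h.item_mem hp)
  have hg := Memory.grows_writeAll n (N.offers H s n d c) s
  have hwrite : N.Invariant H Hp B X V (s.writeAll n (N.offers H s n d c)) :=
    h.writeAll
      (fun a ha => scope_subset hB hd (h.item_mem hp)
        (mem_scope_of_mem_offers hB h.inBounds hd (h.item_mem hp) ha))
      (fun a ha => snd_mem_of_mem_offers hB h.values (h.log_values d c (hp.subset (by simp))) ha)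
      (fun a ha => justified_of_mem_offers hB h.inBounds hd (h.sound n) (h.logs.covers hp) ha)
  have hview : Dominated (replay (L ++ [c])) ((s.writeAll n (N.offers H s n d c)).marking d) :=
    (h.logs.replay_dominated hp).trans (hg.dominated d)
  rw [e]
  refine (hwrite.update_view hview fun a ha => ?_).tick k
  have hinput : N.kind n ≠ .vertexInput := fun hk => by simp [deps, hk] at hd
  have hcov := h.complete n fun hk => absurd hk hinput
  have hC : InBounds B (Function.update (V n) d (replay (L ++ [c]))) := by
    refine hwrite.inBounds.of_dominated fun k => ?_
    by_cases hk : k = d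
    · subst hk; simpa using hview
    · simpa [hk] using hwrite.view_dominated n k
  have hupdate : replay (L ++ [c]) = Function.update (V n d) c.item (some c.value) := by
    rw [replay_concat, hV]
    congr!
  rw [hupdate] at ha hC
  rcases candidates_update hB hd hC ha with ha | ha
  · exact (hcov a ha).mono (hg.dominated n)
  · exact covers_of_derived hB h.inBounds hd (h.view_dominated n)
      (hV ▸ (h.logs d).1 L c hp) hcov (hg.dominated n)
      (fun b hb => s.covers_writeAll n hb) ha

open Classical in
theorem foldl_handleChange (h : N.Invariant H Hp B X V s) (hB : N.Bounds H Hp B X)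
    (hd : d ∈ N.deps n) (he : s.changes d = L ++ P) (hV : V n d = replay L) :
    N.Invariant H Hp B X (Function.update V n (Function.update (V n) d (replay (L ++ P))))
        (P.foldl (N.handleChange H n d) s) ∧
      Memory.Grows n s (P.foldl (N.handleChange H n d) s) ∧
      (P.foldl (N.handleChange H n d) s).steps ≤ s.steps + (P.map (N.cost B n d)).sum := by
  induction P generalizing L V s with
  | nil =>
    refine ⟨?_, Memory.Grows.refl n s, by simp⟩
    rw [List.append_nil, ← hV, Function.update_eq_self, Function.update_eq_self]
    exact h
  | cons c P ih =>
    have hp : L ++ [c] <+: s.changes d := ⟨P, by rw [he]; simp⟩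
    have hg := grows_handleChange (H := H) hB h.inBounds hd (h.item_mem hp)
    have hsteps := steps_handleChange_le (H := H) hB h.inBounds hd (h.item_mem hp)
    obtain ⟨hinv, hgrows, hle⟩ := ih (L := L ++ [c]) (h.handleChange hB hd hp hV)
      (by rw [hg.changes_of_ne d (hB.ne_of_mem_deps hd), he]; simp) (by simp)
    refine ⟨by simpa using hinv, hg.trans hgrows, hle.trans ?_⟩
    rw [List.map_cons, List.sum_cons, ← Nat.add_assoc]
    exact Nat.add_le_add_right hsteps _

end Invariant

end MarkingNet

/-! ### Execution of nodes -/

namespace Memory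

variable {ι M : Type*} {s s' s'' : Memory ι M} {n k d : ι} {D D' : Set ι}

/-- The changes of `d` that `n` has handled. -/
def handledChanges (s : Memory ι M) (n d : ι) : List (Change M) :=
  (s.changes d).take (s.handled n d)

/-- The markings of the matches of `d` according to the changes that `n` has handled. -/
noncomputable def view (s : Memory ι M) (n d : ι) : M → Option ℕ∞ := replay (s.handledChanges n d)

/-- The state `s'` arises from `s` by changes of the result set of `n`, after which `n` has handled
the changes in `s` of the nodes in `D`, and no further changes of other nodes. -/
structure Advances (n : ι) (D : Set ι) (s s' : Memory ι M) : Prop where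
  marking_of_ne : ∀ k, k ≠ n → s'.marking k = s.marking k
  changes_of_ne : ∀ k, k ≠ n → s'.changes k = s.changes k
  isPrefix : ∀ k, s.changes k <+: s'.changes k
  handled_of_ne : ∀ k, k ≠ n → s'.handled k = s.handled k
  handled_of_mem : ∀ d ∈ D, s'.handled n d = (s.changes d).length
  handled_of_notMem : ∀ d ∉ D, s'.handled n d = s.handled n d
  loaded_of_ne : ∀ k, k ≠ n → s'.loaded k = s.loaded k

namespace Advances

theorem refl (n : ι) (hD : ∀ d ∈ D, s.handled n d = (s.changes d).length) : Advances n D s s :=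
  ⟨fun _ _ => rfl, fun _ _ => rfl, fun _ => List.prefix_refl _, fun _ _ => rfl, hD, fun _ _ => rfl,
    fun _ _ => rfl⟩

theorem trans (h : Advances n D s s') (h' : Advances n D' s' s'') (hn : n ∉ D') :
    Advances n (D ∪ D') s s'' where
  marking_of_ne k hk := (h'.marking_of_ne k hk).trans (h.marking_of_ne k hk)
  changes_of_ne k hk := (h'.changes_of_ne k hk).trans (h.changes_of_ne k hk)
  isPrefix k := (h.isPrefix k).trans (h'.isPrefix k)
  handled_of_ne k hk := (h'.handled_of_ne k hk).trans (h.handled_of_ne k hk)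
  handled_of_mem d hd := by
    by_cases hd' : d ∈ D'
    · rw [h'.handled_of_mem d hd', h.changes_of_ne d (ne_of_mem_of_not_mem hd' hn)]
    · rw [h'.handled_of_notMem d hd', h.handled_of_mem d (hd.resolve_right hd')]
  handled_of_notMem d hd := (h'.handled_of_notMem d fun hd' => hd (Or.inr hd')).trans
    (h.handled_of_notMem d fun hd' => hd (Or.inl hd'))
  loaded_of_ne k hk := (h'.loaded_of_ne k hk).trans (h.loaded_of_ne k hk)

theorem tick (h : Advances n D s s') (l : ℕ) : Advances n D s (s'.tick l) :=
  ⟨h.1, h.2, h.3, h.4, h.5, h.6, h.7⟩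

theorem handled_le (h : Advances n D s s') (hle : ∀ k d, s.handled k d ≤ (s.changes d).length)
    (k d : ι) : s'.handled k d ≤ (s'.changes d).length := by
  refine le_trans ?_ (h.isPrefix d).length_le
  by_cases hk : k = n
  · subst hk
    by_cases hd : d ∈ D
    · exact (h.handled_of_mem d hd).le
    · exact (h.handled_of_notMem d hd).le.trans (hle k d)
  · rw [h.handled_of_ne k hk]
    exact hle k d

theorem handledChanges_of_mem (h : Advances n D s s') (hn : n ∉ D) (hd : d ∈ D) :
    s'.handledChanges n d = s.changes d := by
  rw [handledChanges, h.handled_of_mem d hd, h.changes_of_ne d (ne_of_mem_of_not_mem hd hn),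
    List.take_length]

theorem handledChanges_eq (h : Advances n D s s')
    (hle : ∀ k d, s.handled k d ≤ (s.changes d).length) (hk : k ≠ n ∨ d ∉ D) :
    s'.handledChanges k d = s.handledChanges k d := by
  have heq : s'.handled k d = s.handled k d := by
    by_cases hkn : k = n
    · subst hkn
      exact h.handled_of_notMem d (hk.resolve_left (not_not_intro rfl))
    · rw [h.handled_of_ne k hkn]
  obtain ⟨L, hL⟩ := h.isPrefix d
  rw [handledChanges, heq, ← hL, List.take_append_of_le_length (hle k d), handledChanges]

theorem view_eq_of_empty (h : Advances n ∅ s s')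
    (hle : ∀ k d, s.handled k d ≤ (s.changes d).length) : s'.view = s.view := by
  funext k e
  rw [view, h.handledChanges_eq hle (Or.inr (Set.notMem_empty e)), view]

open Classical in
theorem view_eq_update (h : Advances n {d} s s')
    (hle : ∀ k d, s.handled k d ≤ (s.changes d).length) (hd : d ≠ n) :
    s'.view =
      Function.update s.view n (Function.update (s.view n) d (replay (s.changes d))) := by
  have eq_view {k e : ι} (hk : k ≠ n ∨ e ∉ ({d} : Set ι)) : s'.view k e = s.view k e := by
    rw [view, h.handledChanges_eq hle hk, view]
  funext k e
  by_cases hk : k = n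
  · subst hk
    by_cases he : e = d
    · subst he
      simp [view, h.handledChanges_of_mem (Ne.symm hd : k ∉ ({e} : Set ι)) rfl]
    · simp [he, eq_view (Or.inr he : k ≠ k ∨ e ∉ ({d} : Set ι))]
  · simp [hk, eq_view (Or.inl hk)]

end Advances

theorem Grows.advances_empty (h : Grows n s s') : Advances n ∅ s s' where
  marking_of_ne := h.marking_of_ne
  changes_of_ne := h.changes_of_ne
  isPrefix := h.isPrefix
  handled_of_ne _ _ := by rw [h.handled]
  handled_of_mem _ hd := hd.elim
  handled_of_notMem _ _ := by rw [h.handled]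
  loaded_of_ne _ _ := by rw [h.loaded]

open Classical in
/-- One step in which `n` takes note of all changes of `d`. -/
noncomputable def acknowledge (s : Memory ι M) (n d : ι) : Memory ι M :=
  { s.tick 1 with
    handled := Function.update s.handled n
      (Function.update (s.handled n) d (s.changes d).length) }

theorem advances_acknowledge (s : Memory ι M) (n d : ι) :
    Advances n {d} s (s.acknowledge n d) where
  marking_of_ne _ _ := rfl
  changes_of_ne _ _ := rfl
  isPrefix _ := List.prefix_refl _
  handled_of_ne k hk := by simp [acknowledge, hk]
  handled_of_mem e he := by subst he; simp [acknowledge]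
  handled_of_notMem e he := by simp [acknowledge, show e ≠ d from he]
  loaded_of_ne _ _ := rfl

open Classical in
/-- Mark `n` as loaded. -/
noncomputable def load (s : Memory ι M) (n : ι) : Memory ι M :=
  { s with loaded := Function.update s.loaded n true }

theorem advances_load (s : Memory ι M) (n : ι) : Advances n ∅ s (s.load n) :=
  ⟨fun _ _ => rfl, fun _ _ => rfl, fun _ => List.prefix_refl _, fun _ _ => rfl, fun _ h => h.elim,
    fun _ _ => rfl, fun k hk => by simp [load, hk]⟩

theorem write_load (s : Memory ι M) (n : ι) (m : M) (φ : ℕ∞) (k : ι) :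
    (s.load k).write n m φ = (s.write n m φ).load k := by
  unfold write
  simp only [load]
  split
  · rfl
  · split_ifs <;> rfl

theorem writeAll_load (s : Memory ι M) (n : ι) (L : List (M × ℕ∞)) (k : ι) :
    writeAll n L (s.load k) = (writeAll n L s).load k := by
  induction L generalizing s with
  | nil => rfl
  | cons a L ih => rw [writeAll_cons, write_load, ih, writeAll_cons]

end Memory

namespace MarkingNet

variable {TV TE VQ EQ VH EH ι : Type*} {TG : DirGraph TV TE} {Q : TypedGraph TG VQ EQ}
  {N : MarkingNet Q.toDirGraph ι} {H : TypedGraph TG VH EH} {Hp : Subgraph H.toDirGraph}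
  {B : ι → Set (PMap VQ EQ VH EH)} {X : Set ℕ∞}
  {s s' s'' : Memory ι (PMap VQ EQ VH EH)} {n d k : ι} {D D' : Set ι}

/-- The dependencies of a node, in the order in which the node handles their changes. -/
noncomputable def depList (N : MarkingNet Q.toDirGraph ι) (n : ι) : List ι :=
  match N.kind n with
  | .vertexInput => []
  | .union D => D.toList
  | .navigation d => [d]
  | .projection d => [d]
  | .assignment _ d => [d]
  | .filter _ d => [d]
  | .join l r => [l, r]

theorem mem_depList : d ∈ N.depList n ↔ d ∈ N.deps n := by
  unfold depList deps
  cases N.kind n <;> simp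

theorem kind_ne_vertexInput (hd : d ∈ N.deps n) : N.kind n ≠ .vertexInput := fun hk => by
  simp [deps, hk] at hd

theorem candidates_congr {C C' : ι → PMap VQ EQ VH EH → Option ℕ∞}
    (h : ∀ d ∈ N.deps n, C d = C' d) : N.candidates H Hp C n = N.candidates H Hp C' n := by
  have derived_eq {d m φ} : N.derived H C n d m φ = N.derived H C' n d m φ := by
    cases hk : N.kind n
    case join l r =>
      have hother : otherDep l r d ∈ N.deps n := by
        unfold otherDep
        split_ifs <;> simp [deps, hk]
      simp only [derived, hk, h _ hother]
    all_goals exact derived_congr (by simp [hk])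
  ext a
  simp only [candidates, Set.mem_ofPred_eq]
  refine or_congr Iff.rfl (exists_congr fun d => and_congr_right fun hd => ?_)
  simp only [h d hd, derived_eq]

open Classical in
theorem Invariant.load {V : ι → ι → PMap VQ EQ VH EH → Option ℕ∞} (h : N.Invariant H Hp B X V s)
    (hcov : ∀ a ∈ N.candidates H Hp (V n) n, Covers (s.marking n) a) :
    N.Invariant H Hp B X V (s.load n) := by
  refine ⟨h.logs, h.inBounds, h.log_values, h.sound, h.view_dominated, fun k hk => ?_⟩
  by_cases hkn : k = n
  · exact hkn ▸ hcov
  · exact h.complete k fun hinput => by simpa [Memory.load, hkn] using hk hinput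

theorem setOf_marking_eq_setOf_isGreatest {M : Type*} {f : M → Option ℕ∞}
    {S : Set (M × ℕ∞)} (hsound : ∀ m φ, f m = some φ → Justified S (m, φ))
    (hcomplete : ∀ a ∈ S, Covers f a) :
    {a : M × ℕ∞ | f a.1 = some a.2} = {a | IsGreatest {φ | (a.1, φ) ∈ S} a.2} := by
  ext ⟨m, φ⟩
  constructor
  · intro (e : f m = some φ)
    have hmax : ∀ ψ, (m, ψ) ∈ S → ψ ≤ φ := fun ψ hψ => by
      obtain ⟨χ, hχ, hle⟩ := hcomplete _ hψ
      exact hle.trans (Option.some.inj (hχ.symm.trans e)).le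
    obtain ⟨ψ, hle, hψ⟩ := hsound m φ e
    exact ⟨le_antisymm hle (hmax ψ hψ) ▸ hψ, hmax⟩
  · rintro ⟨hφ, hmax⟩
    obtain ⟨ψ, hψ, hle⟩ := hcomplete _ hφ
    obtain ⟨χ, hle', hχ⟩ := hsound m ψ hψ
    exact hψ.trans (congrArg some (le_antisymm (hle'.trans (hmax hχ)) hle))

/-- A state that can be reached by the procedure. -/
structure Reachable (N : MarkingNet Q.toDirGraph ι) (H : TypedGraph TG VH EH)
    (Hp : Subgraph H.toDirGraph) (B : ι → Set (PMap VQ EQ VH EH)) (X : Set ℕ∞)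
    (s : Memory ι (PMap VQ EQ VH EH)) : Prop where
  invariant : N.Invariant H Hp B X s.view s
  handled_le : ∀ n d, s.handled n d ≤ (s.changes d).length

theorem reachable_empty : N.Reachable H Hp B X Memory.empty where
  invariant := by
    refine ⟨fun _ => ⟨.nil, rfl⟩, fun _ _ _ h => by simp [Memory.empty] at h,
      fun _ _ h => by simp [Memory.empty] at h, fun _ _ _ h => by simp [Memory.empty] at h,
      fun n d m φ h => by simp [Memory.view, Memory.handledChanges, Memory.empty, replay] at h,
      fun n hn a ha => ?_⟩
    rcases ha with ⟨hk, -⟩ | ⟨d, -, m, φ, hφ, -⟩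
    · cases hn hk
    · simp [Memory.view, Memory.handledChanges, Memory.empty, replay] at hφ
  handled_le _ _ := Nat.zero_le _

variable [Finite VQ] [Finite EQ] [Finite VH] [Finite EH]

/-- The steps charged to the changes of `d` that `n` has handled. A step for the notification is
charged to every single change. -/
noncomputable def depCharge (N : MarkingNet Q.toDirGraph ι) (B : ι → Set (PMap VQ EQ VH EH))
    (s : Memory ι (PMap VQ EQ VH EH)) (n d : ι) : ℕ :=
  ((s.handledChanges n d).map fun c => 1 + N.cost B n d c).sum

open Classical in
/-- The steps charged to the executions of `n` so far. -/
noncomputable def nodeCharge (N : MarkingNet Q.toDirGraph ι) (B : ι → Set (PMap VQ EQ VH EH))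
    (s : Memory ι (PMap VQ EQ VH EH)) (n : ι) : ℕ :=
  ∑ d ∈ (N.depList n).toFinset, N.depCharge B s n d +
    if N.kind n = .vertexInput ∧ s.loaded n = true then matchSum (B n) fun m => m.size + 1 else 0

theorem nodeCharge_of_ne (hs : N.Reachable H Hp B X s) (h : Memory.Advances n D s s')
    (hk : k ≠ n) : N.nodeCharge B s' k = N.nodeCharge B s k := by
  unfold nodeCharge depCharge
  rw [h.loaded_of_ne k hk]
  simp only [h.handledChanges_eq hs.handled_le (Or.inl hk)]

theorem nodeCharge_add_depCharge (hs : N.Reachable H Hp B X s)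
    (h : Memory.Advances n {d} s s') (hd : d ∈ N.deps n) :
    N.nodeCharge B s n + N.depCharge B s' n d = N.nodeCharge B s' n + N.depCharge B s n d := by
  classical
  have hmem : d ∈ (N.depList n).toFinset := List.mem_toFinset.2 (mem_depList.2 hd)
  have hrest : ∑ e ∈ (N.depList n).toFinset.erase d, N.depCharge B s' n e =
      ∑ e ∈ (N.depList n).toFinset.erase d, N.depCharge B s n e :=
    Finset.sum_congr rfl fun e he => by
      rw [depCharge, h.handledChanges_eq hs.handled_le (Or.inr (Finset.ne_of_mem_erase he)),
        depCharge]
  unfold nodeCharge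
  simp only [kind_ne_vertexInput hd, false_and, if_false]
  rw [← Finset.add_sum_erase _ _ hmem, ← Finset.add_sum_erase _ _ hmem, hrest]
  omega

/-- The state `s'` arises from `s` by work of the node `n`, which thereby handles the changes of
the nodes in `D` and takes no more steps than are charged to it. -/
structure Progress (N : MarkingNet Q.toDirGraph ι) (H : TypedGraph TG VH EH)
    (Hp : Subgraph H.toDirGraph) (B : ι → Set (PMap VQ EQ VH EH)) (X : Set ℕ∞) (n : ι) (D : Set ι)
    (s s' : Memory ι (PMap VQ EQ VH EH)) : Prop where
  reachable : N.Reachable H Hp B X s'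
  advances : Memory.Advances n D s s'
  steps_le : s'.steps + N.nodeCharge B s n ≤ s.steps + N.nodeCharge B s' n

theorem Progress.refl (hs : N.Reachable H Hp B X s)
    (hD : ∀ d ∈ D, s.handled n d = (s.changes d).length) : N.Progress H Hp B X n D s s :=
  ⟨hs, .refl n hD, le_rfl⟩

theorem Progress.trans (h : N.Progress H Hp B X n D s s') (h' : N.Progress H Hp B X n D' s' s'')
    (hn : n ∉ D') : N.Progress H Hp B X n (D ∪ D') s s'' :=
  ⟨h'.reachable, h.advances.trans h'.advances hn, by
    have hle := h.steps_le
    have hle' := h'.steps_le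
    omega⟩

open Classical in
theorem progress_handleDep (hB : N.Bounds H Hp B X) (hs : N.Reachable H Hp B X s)
    (hd : d ∈ N.deps n) : N.Progress H Hp B X n {d} s (N.handleDep H n s d) := by
  have hdn := hB.ne_of_mem_deps hd
  have hsplit : s.changes d = s.handledChanges n d ++ (s.changes d).drop (s.handled n d) :=
    (List.take_append_drop _ _).symm
  unfold handleDep
  set P := (s.changes d).drop (s.handled n d) with hP
  dsimp only
  split_ifs with hnil
  · refine .refl hs fun e he => ?_
    subst he
    exact le_antisymm (hs.handled_le n e) (List.drop_eq_nil_iff.1 hnil)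
  change N.Progress H Hp B X n {d} s (P.foldl (N.handleChange H n d) (s.acknowledge n d))
  have hack : N.Invariant H Hp B X s.view (s.acknowledge n d) :=
    ⟨hs.1.1, hs.1.2, hs.1.3, hs.1.4, hs.1.5, hs.1.6⟩
  obtain ⟨hinv, hgrows, hsteps⟩ := hack.foldl_handleChange hB hd hsplit rfl
  rw [← hsplit] at hinv
  set s' := P.foldl (N.handleChange H n d) (s.acknowledge n d)
  have hadv : Memory.Advances n {d} s s' := by
    simpa using (s.advances_acknowledge n d).trans hgrows.advances_empty (Set.notMem_empty n)
  refine ⟨⟨?_, hadv.handled_le hs.handled_le⟩, hadv, ?_⟩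
  · rwa [hadv.view_eq_update hs.handled_le hdn]
  · have hcharge := nodeCharge_add_depCharge (B := B) hs hadv hd
    have hnew : N.depCharge B s' n d =
        N.depCharge B s n d + (P.length + (P.map (N.cost B n d)).sum) := by
      rw [depCharge, hadv.handledChanges_of_mem (Ne.symm hdn : n ∉ ({d} : Set ι)) rfl, hsplit,
        List.map_append, List.sum_append, depCharge, List.sum_map_add]
      simp
    have hpos : 0 < P.length := List.length_pos_iff.2 hnil
    have hone : (s.acknowledge n d).steps = s.steps + 1 := rfl
    omega

theorem progress_foldl_handleDep (hB : N.Bounds H Hp B X) (hs : N.Reachable H Hp B X s)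
    {L : List ι} (hL : ∀ d ∈ L, d ∈ N.deps n) :
    N.Progress H Hp B X n {d | d ∈ L} s (L.foldl (N.handleDep H n) s) := by
  induction L generalizing s with
  | nil => exact .refl hs fun _ hd => absurd hd List.not_mem_nil
  | cons d L ih =>
    have hhead := progress_handleDep hB hs (hL d List.mem_cons_self)
    have htail := ih hhead.reachable fun e he => hL e (List.mem_cons_of_mem d he)
    have hn : n ∉ {e | e ∈ L} := fun hn => hB.notMem_deps n (hL n (List.mem_cons_of_mem d hn))
    have hset : {e | e ∈ d :: L} = {d} ∪ {e | e ∈ L} := by ext e; simp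
    exact hset ▸ hhead.trans htail hn

theorem runNode_eq_foldl (hn : N.kind n ≠ .vertexInput) :
    N.runNode H Hp s n = (N.depList n).foldl (N.handleDep H n) s := by
  unfold runNode depList
  cases hk : N.kind n <;> simp_all

theorem runNode_of_loaded (hk : N.kind n = .vertexInput) (hl : s.loaded n = true) :
    N.runNode H Hp s n = s := by simp [runNode, hk, hl]

theorem exists_runNode_eq (hB : N.Bounds H Hp B X) (hk : N.kind n = .vertexInput)
    (hl : s.loaded n = false) :
    ∃ (L : List (PMap VQ EQ VH EH × ℕ∞)) (k : ℕ), (∀ a, a ∈ L ↔ a ∈ N.candidates H Hp s.marking n) ∧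
      k ≤ (matchSum (B n) fun m => m.size + 1) ∧
      N.runNode H Hp s n = ((s.writeAll n L).load n).tick k := by
  have hclosed := hB.closedAt n
  simp only [ClosedAt, hk] at hclosed
  set L := (enumerate (allMatches Q H (N.query n) Hp)).map fun m => (m, (⊤ : ℕ∞)) with hL
  refine ⟨L, (L.map fun a => a.1.size + 1).sum, fun a => ?_, ?_, ?_⟩
  · rw [candidates_vertexInput hk, hL, List.mem_map]
    refine ⟨?_, fun ha => ⟨a.1, mem_enumerate.2 ha.1, Prod.ext rfl ha.2.symm⟩⟩
    rintro ⟨m, hm, rfl⟩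
    exact ⟨mem_enumerate.1 hm, rfl⟩
  · rw [hL, List.map_map]
    exact list_sum_le_matchSum (nodup_enumerate _) (fun m hm => hclosed.1 (mem_enumerate.1 hm)) _
  · rw [← Memory.writeAll_load, ← offerAll_eq]
    simp only [runNode, hk, hl]
    rfl

theorem progress_runNode_vertexInput (hB : N.Bounds H Hp B X) (hs : N.Reachable H Hp B X s)
    (hk : N.kind n = .vertexInput) : N.Progress H Hp B X n ∅ s (N.runNode H Hp s n) := by
  by_cases hl : s.loaded n = true
  · rw [runNode_of_loaded hk hl]
    exact .refl hs fun _ hd => hd.elim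
  obtain ⟨L, k, hL, hle, e⟩ := exists_runNode_eq (Hp := Hp) hB hk (Bool.eq_false_of_not_eq_true hl)
  rw [candidates_vertexInput hk] at hL
  have hclosed := hB.closedAt n
  simp only [ClosedAt, hk] at hclosed
  have hwrite : N.Invariant H Hp B X s.view (s.writeAll n L) := by
    refine hs.invariant.writeAll (fun a ha => hclosed.1 ((hL a).1 ha).1)
      (fun a ha => ((hL a).1 ha).2 ▸ hclosed.2) fun a ha => ⟨a.2, le_rfl, ?_⟩
    rw [candidates_vertexInput hk]
    exact (hL a).1 ha
  have hload : N.Invariant H Hp B X s.view (((s.writeAll n L).load n).tick k) := by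
    refine (hwrite.load fun a ha => s.covers_writeAll n ((hL a).2 ?_)).tick k
    rwa [candidates_vertexInput hk] at ha
  have hadv : Memory.Advances n ∅ s (((s.writeAll n L).load n).tick k) := by
    simpa using ((Memory.grows_writeAll n L s).advances_empty.trans
      (Memory.advances_load _ n) (Set.notMem_empty n)).tick k
  rw [e]
  refine ⟨⟨hadv.view_eq_of_empty hs.handled_le ▸ hload, hadv.handled_le hs.handled_le⟩, hadv, ?_⟩
  have hsteps : (((s.writeAll n L).load n).tick k).steps = s.steps + k :=
    congrArg (· + k) (Memory.steps_writeAll n L s)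
  have hloaded : (((s.writeAll n L).load n).tick k).loaded n = true := by
    simp [Memory.tick, Memory.load]
  simp only [nodeCharge, depList, hk, hl, hloaded, hsteps, List.toFinset_nil, Finset.sum_empty]
  simpa using hle

theorem progress_runNode (hB : N.Bounds H Hp B X) (hs : N.Reachable H Hp B X s) (n : ι) :
    N.Progress H Hp B X n (N.deps n) s (N.runNode H Hp s n) := by
  by_cases hk : N.kind n = .vertexInput
  · have hdeps : N.deps n = ∅ := by simp [deps, hk]
    exact hdeps ▸ progress_runNode_vertexInput hB hs hk
  · rw [runNode_eq_foldl hk]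
    convert progress_foldl_handleDep hB hs fun d hd => mem_depList.1 hd using 1
    exact Set.ext fun d => mem_depList.symm

theorem loaded_runNode (hB : N.Bounds H Hp B X) (hk : N.kind n = .vertexInput) :
    (N.runNode H Hp s n).loaded n = true := by
  by_cases hl : s.loaded n = true
  · rwa [runNode_of_loaded hk hl]
  · obtain ⟨L, k, -, -, e⟩ := exists_runNode_eq (s := s) hB hk (Bool.eq_false_of_not_eq_true hl)
    simp [e, Memory.tick, Memory.load]

open Classical in
theorem config_runNode (hB : N.Bounds H Hp B X) (hs : N.Reachable H Hp B X s) (n : ι) :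
    (N.runNode H Hp s n).config = Function.update s.config n (N.results H Hp s.config n) := by
  have h := progress_runNode hB hs n
  set s' := N.runNode H Hp s n with hs'
  have hview : N.candidates H Hp (s'.view n) n = N.candidates H Hp s.marking n :=
    candidates_congr fun d hd => by
      rw [Memory.view, h.advances.handledChanges_of_mem (hB.notMem_deps n) hd]
      exact (hs.invariant.logs d).2
  have hmarking : N.candidates H Hp s'.marking n = N.candidates H Hp s.marking n :=
    candidates_congr fun d hd => h.advances.marking_of_ne d (hB.ne_of_mem_deps hd)
  have hsound := h.reachable.invariant.sound n
  have hcomplete := h.reachable.invariant.complete n (loaded_runNode hB)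
  rw [hmarking] at hsound
  rw [hview] at hcomplete
  funext k
  by_cases hk : k = n
  · subst hk
    rw [Function.update_self]
    exact (setOf_marking_eq_setOf_isGreatest hsound hcomplete).trans
      (results_eq_candidates hB hs.invariant.inBounds k).symm
  · rw [Function.update_of_ne hk]
    simp only [Memory.config, h.advances.marking_of_ne k hk]

theorem foldl_runNode_spec (hB : N.Bounds H Hp B X) {O : List ι} (hO : ∀ n ∈ O, n ∈ N.nodes)
    (hs : N.Reachable H Hp B X s) :
    N.Reachable H Hp B X (O.foldl (N.runNode H Hp) s) ∧
      (O.foldl (N.runNode H Hp) s).config = N.execute H Hp O s.config ∧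
      (O.foldl (N.runNode H Hp) s).steps + ∑ n ∈ N.nodes, N.nodeCharge B s n ≤
        s.steps + ∑ n ∈ N.nodes, N.nodeCharge B (O.foldl (N.runNode H Hp) s) n := by
  classical
  induction O generalizing s with
  | nil => exact ⟨hs, rfl, le_rfl⟩
  | cons n O ih =>
    have h := progress_runNode hB hs n
    obtain ⟨hreach, hconfig, hsteps⟩ := ih (fun k hk => hO k (List.mem_cons_of_mem n hk))
      h.reachable
    refine ⟨hreach, ?_, ?_⟩
    · rw [List.foldl_cons, hconfig, config_runNode hB hs n]
      rfl
    · have hn := hO n List.mem_cons_self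
      have hrest := Finset.sum_congr (s₁ := N.nodes.erase n) rfl fun k hk =>
        nodeCharge_of_ne hs h.advances (Finset.ne_of_mem_erase hk)
      have hstep := h.steps_le
      rw [List.foldl_cons, ← Finset.add_sum_erase _ _ hn]
      rw [← Finset.add_sum_erase _ _ hn, hrest] at hsteps
      omega

theorem run_spec (hB : N.Bounds H Hp B X) {O : List ι} (hO : ∀ n ∈ O, n ∈ N.nodes) :
    N.Reachable H Hp B X (N.run H Hp O) ∧
      (N.run H Hp O).config = N.execute H Hp O (fun _ => ∅) ∧
      (N.run H Hp O).steps ≤ ∑ n ∈ N.nodes, N.nodeCharge B (N.run H Hp O) n := by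
  obtain ⟨hreach, hconfig, hsteps⟩ := foldl_runNode_spec hB hO reachable_empty
  refine ⟨hreach, hconfig.trans (congrArg _ ?_), ?_⟩
  · funext n
    ext a
    simp [Memory.config, Memory.empty]
  · exact (Nat.le_add_right _ _).trans (hsteps.trans (Nat.zero_add _).le)

end MarkingNet

/-! ### The number of changes -/

section Potential

variable {M : Type*} {X : Set ℕ∞} {φ ψ : ℕ∞}

/-- The number of markings in `X` up to `φ`. It bounds the number of changes after which the marking
of a match is `φ` if all markings lie in `X`. -/
noncomputable def markingRank (X : Set ℕ∞) (φ : ℕ∞) : ℕ := (X ∩ Set.Iic φ).ncard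

theorem markingRank_le_ncard (hX : X.Finite) (φ : ℕ∞) : markingRank X φ ≤ X.ncard :=
  Set.ncard_le_ncard Set.inter_subset_left hX

theorem markingRank_lt_markingRank (hX : X.Finite) (hψ : ψ ∈ X) (hlt : φ < ψ) :
    markingRank X φ < markingRank X ψ := by
  refine Set.ncard_lt_ncard ⟨?_, fun h => ?_⟩ (hX.inter_of_left _)
  · exact Set.inter_subset_inter_right X (Set.Iic_subset_Iic.2 hlt.le)
  · exact hlt.not_ge (h ⟨hψ, Set.self_mem_Iic⟩).2

/-- The potential of a match in the amortized analysis of a change log, where `a` bounds the cost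
of an addition and `b` that of an increase of a marking. -/
noncomputable def changePotential (X : Set ℕ∞) (a b : M → ℕ) (m : M) : Option ℕ∞ → ℕ
  | none => 0
  | some φ => a m + markingRank X φ * b m

theorem changePotential_le (hX : X.Finite) (a b : M → ℕ) (m : M) (o : Option ℕ∞) :
    changePotential X a b m o ≤ a m + X.ncard * b m := by
  cases o with
  | none => exact Nat.zero_le _
  | some φ => exact Nat.add_le_add_left (Nat.mul_le_mul_right _ (markingRank_le_ncard hX φ)) _

theorem Change.Fits.add_changePotential_le {c : Change M} {f : M → Option ℕ∞} (hc : c.Fits f)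
    (hX : X.Finite) (hcX : c.value ∈ X) {cost : Change M → ℕ} {a b : M → ℕ}
    (ha : ∀ m φ, cost (.added m φ) ≤ a m) (hb : ∀ m φ, cost (.raised m φ) ≤ b m) :
    cost c + changePotential X a b c.item (f c.item) ≤
      changePotential X a b c.item (some c.value) := by
  cases c with
  | added m φ =>
    have hnone : f m = none := hc
    simpa only [item, hnone, changePotential, Nat.add_zero] using
      (ha m φ).trans (Nat.le_add_right _ _)
  | raised m φ =>
    obtain ⟨ψ, hψ, hlt⟩ := hc
    simp only [item, value, hψ, changePotential]
    calc cost (.raised m φ) + (a m + markingRank X ψ * b m)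
        ≤ b m + (a m + markingRank X ψ * b m) := Nat.add_le_add_right (hb m φ) _
      _ = a m + (markingRank X ψ + 1) * b m := by ring
      _ ≤ a m + markingRank X φ * b m := by
        gcongr
        exact markingRank_lt_markingRank hX hcX hlt

open Classical in
theorem matchSum_update {α β : Type*} [Finite α] {S : Set α} (g : α → β → ℕ) (f : α → β) {i : α}
    (hi : i ∈ S) (y : β) :
    matchSum S (fun m => g m (Function.update f i y m)) + g i (f i) =
      matchSum S (fun m => g m (f m)) + g i y := by
  have hi' : i ∈ S.toFinite.toFinset := by simpa using hi
  have herase : ∑ m ∈ S.toFinite.toFinset.erase i, g m (Function.update f i y m) =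
      ∑ m ∈ S.toFinite.toFinset.erase i, g m (f m) :=
    Finset.sum_congr rfl fun m hm => by rw [Function.update_of_ne (Finset.ne_of_mem_erase hm)]
  rw [matchSum, matchSum, ← Finset.add_sum_erase _ _ hi', ← Finset.add_sum_erase _ _ hi', herase,
    Function.update_self]
  omega

/-- Every match is added once, and then its marking is increased at most `X.ncard` times. -/
theorem ValidLog.sum_le [Finite M] {L : List (Change M)} (hL : ValidLog L) (hX : X.Finite)
    (hLX : ∀ c ∈ L, c.value ∈ X) {S : Set M} (hLS : ∀ c ∈ L, c.item ∈ S) {cost : Change M → ℕ}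
    {a b : M → ℕ} (ha : ∀ m φ, cost (.added m φ) ≤ a m)
    (hb : ∀ m φ, cost (.raised m φ) ≤ b m) :
    (L.map cost).sum ≤ matchSum S fun m => a m + X.ncard * b m := by
  suffices h : (L.map cost).sum ≤ matchSum S fun m => changePotential X a b m (replay L m) from
    h.trans (matchSum_mono subset_rfl fun m _ => changePotential_le hX a b m _)
  induction L using List.reverseRecOn with
  | nil => exact Nat.zero_le _
  | append_singleton L c ih =>
    have hsum := ih (hL.of_isPrefix (List.prefix_append _ _)) (fun c hc => hLX c (by simp [hc]))
      fun c hc => hLS c (by simp [hc])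
    have hstep := (hL L c (List.prefix_refl _)).add_changePotential_le hX (hLX c (by simp)) ha hb
    have hupdate := matchSum_update (changePotential X a b) (replay L) (hLS c (by simp))
      (some c.value)
    rw [List.map_append, List.sum_append, List.map_singleton, List.sum_singleton, replay_concat]
    omega

end Potential

/-! ### The charges of the nodes -/

section MatchSum

variable {α β : Type*} [Finite α]

theorem matchSum_add (S : Set α) (f g : α → ℕ) :
    matchSum S (fun m => f m + g m) = matchSum S f + matchSum S g := Finset.sum_add_distrib

theorem matchSum_mul (S : Set α) (k : ℕ) (f : α → ℕ) :
    matchSum S (fun m => k * f m) = k * matchSum S f := (Finset.mul_sum _ _ _).symm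

theorem matchSum_const (S : Set α) (k : ℕ) : matchSum S (fun _ => k) = S.ncard * k := by
  rw [matchSum, Finset.sum_const, smul_eq_mul, Set.ncard_eq_toFinset_card S S.toFinite]

theorem matchSum_singleton (m : α) (f : α → ℕ) : matchSum {m} f = f m := by
  simp [matchSum]

theorem matchSum_fiber_le [Finite β] (S : Set α) (T : Set β) (r : β → α) (f : β → ℕ) :
    matchSum S (fun m => matchSum {m' | m' ∈ T ∧ r m' = m} f) ≤ matchSum T f := by
  classical
  have hfilter (m : α) : ({m' | m' ∈ T ∧ r m' = m} : Set β).toFinite.toFinset =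
      T.toFinite.toFinset.filter fun m' => r m' = m := by
    ext
    simp
  simp only [matchSum, hfilter]
  exact (Finset.sum_fiberwise_eq_sum_filter _ _ r f).le.trans
    (Finset.sum_le_sum_of_subset (Finset.filter_subset _ _))

end MatchSum

/-- The sum of the sizes of the matches in `S`, each increased by `q`. -/
noncomputable def weight {VQ EQ VH EH : Type*} [Finite VQ] [Finite EQ] [Finite VH] [Finite EH]
    (q : ℕ) (S : Set (PMap VQ EQ VH EH)) : ℕ :=
  matchSum S fun m => m.size + q

namespace MarkingNet

variable {TV TE VQ EQ VH EH ι : Type*} {TG : DirGraph TV TE} {Q : TypedGraph TG VQ EQ}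
  {N : MarkingNet Q.toDirGraph ι} {H : TypedGraph TG VH EH} {Hp : Subgraph H.toDirGraph}
  {B : ι → Set (PMap VQ EQ VH EH)} {X : Set ℕ∞} {s : Memory ι (PMap VQ EQ VH EH)} {n d : ι} {q : ℕ}

theorem Reachable.item_mem (hs : N.Reachable H Hp B X s) {c : Change (PMap VQ EQ VH EH)}
    (hc : c ∈ s.changes d) : c.item ∈ B d := by
  obtain ⟨L, L', hL⟩ := List.append_of_mem hc
  exact hs.invariant.item_mem (L := L) ⟨L', by simp [hL]⟩

variable [Finite VQ] [Finite EQ] [Finite VH] [Finite EH]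

theorem Reachable.depCharge_le (hs : N.Reachable H Hp B X s) (hX : X.Finite) (hq : X.ncard ≤ q)
    (hq₀ : 0 < q) (n d : ι) : N.depCharge B s n d ≤
      3 * weight q (B d) + 2 * matchSum (B d) fun m => weight q (N.scope B n d m) := by
  have hmem {c} (hc : c ∈ s.handledChanges n d) : c ∈ s.changes d := List.mem_of_mem_take hc
  have hsum := ((hs.invariant.logs d).1.of_isPrefix (List.take_prefix _ _)).sum_le hX
    (fun c hc => hs.invariant.log_values d c (hmem hc)) (fun c hc => hs.item_mem (hmem hc))
    (cost := fun c => 1 + N.cost B n d c)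
    (a := fun m => 1 + (m.size + matchSum (N.scope B n d m) fun m' => m'.size + 1))
    (b := fun m => 1 + (1 + matchSum (N.scope B n d m) fun _ => 1))
    (fun _ _ => le_rfl) fun _ _ => le_rfl
  refine hsum.trans ?_
  unfold weight
  rw [← matchSum_mul, ← matchSum_mul, ← matchSum_add]
  refine matchSum_mono subset_rfl fun m _ => ?_
  have hscope : matchSum (N.scope B n d m) (fun m' => m'.size + 1) +
      X.ncard * matchSum (N.scope B n d m) (fun _ => 1) ≤
      2 * matchSum (N.scope B n d m) fun m' => m'.size + q := by
    rw [← matchSum_mul, ← matchSum_mul, ← matchSum_add]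
    exact matchSum_mono subset_rfl fun m' _ => by omega
  linarith

theorem Reachable.depCharge_le_of_weight_scope_le (hs : N.Reachable H Hp B X s) (hX : X.Finite)
    (hq : X.ncard ≤ q) (hq₀ : 0 < q) (hscope : ∀ m, weight q (N.scope B n d m) ≤ m.size + q) :
    N.depCharge B s n d ≤ 5 * weight q (B d) := by
  have hle := hs.depCharge_le hX hq hq₀ n d
  have hsum : (matchSum (B d) fun m => weight q (N.scope B n d m)) ≤ weight q (B d) :=
    matchSum_mono subset_rfl fun m _ => hscope m
  omega

theorem Reachable.depCharge_le_of_scope_eq_fiber (hs : N.Reachable H Hp B X s) (hX : X.Finite)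
    (hq : X.ncard ≤ q) (hq₀ : 0 < q)
    (hscope : ∀ m, N.scope B n d m = {m' | m' ∈ B n ∧ m'.restrict (N.query d) = m}) :
    N.depCharge B s n d ≤ 3 * weight q (B d) + 2 * weight q (B n) := by
  have hle := hs.depCharge_le hX hq hq₀ n d
  have hsum : (matchSum (B d) fun m => weight q (N.scope B n d m)) ≤ weight q (B n) := by
    simp only [hscope, weight]
    exact matchSum_fiber_le (B d) (B n) (fun m' => m'.restrict (N.query d)) fun m => m.size + q
  omega

/-- An upper bound for the charge of a node in terms of the weights of the bounding sets. -/
noncomputable def chargeBound (N : MarkingNet Q.toDirGraph ι) (B : ι → Set (PMap VQ EQ VH EH))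
    (q : ℕ) (n : ι) : ℕ :=
  match N.kind n with
  | .vertexInput => weight q (B n)
  | .union D => ∑ d ∈ D, 5 * weight q (B d)
  | .navigation d => 3 * weight q (B d) + 2 * weight q (B n)
  | .projection d => 5 * weight q (B d)
  | .assignment _ d => 5 * weight q (B d)
  | .filter _ d => 5 * weight q (B d)
  | .join l r => 3 * weight q (B l) + 3 * weight q (B r) + 4 * weight q (B n)

theorem Reachable.nodeCharge_le (hB : N.Bounds H Hp B X) (hs : N.Reachable H Hp B X s)
    (hX : X.Finite) (hq : X.ncard ≤ q) (hq₀ : 0 < q) (n : ι) :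
    N.nodeCharge B s n ≤ N.chargeBound B q n := by
  have hsingle {d} := hs.depCharge_le_of_weight_scope_le (n := n) (d := d) hX hq hq₀
  have hfiber {d} := hs.depCharge_le_of_scope_eq_fiber (n := n) (d := d) hX hq hq₀
  have hweight (m : PMap VQ EQ VH EH) : weight q {m} ≤ m.size + q := (matchSum_singleton m _).le
  unfold nodeCharge chargeBound
  cases hk : N.kind n <;> simp only [scope, hk] at hsingle hfiber
  case vertexInput =>
    simp only [depList, hk, List.toFinset_nil, Finset.sum_empty, true_and, Nat.zero_add]
    split_ifs
    · exact matchSum_mono subset_rfl fun m _ => by omega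
    · exact Nat.zero_le _
  case union D =>
    simp only [depList, hk, reduceCtorEq, false_and, if_false, Nat.add_zero,
      Finset.toList_toFinset]
    exact Finset.sum_le_sum fun d _ => hsingle hweight
  case navigation d => simpa [depList, hk] using hfiber (d := d) fun _ => trivial
  case projection d =>
    simpa [depList, hk] using hsingle (d := d) fun m =>
      (hweight _).trans (Nat.add_le_add_right (m.size_restrict_le (N.query n)) q)
  case assignment x d => simpa [depList, hk] using hsingle (d := d) hweight
  case filter x d => simpa [depList, hk] using hsingle (d := d) hweight
  case join l r =>
    have hl := hfiber (d := l) fun _ => trivial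
    have hr := hfiber (d := r) fun _ => trivial
    simp only [depList, hk, reduceCtorEq, false_and, if_false, Nat.add_zero, List.toFinset_cons,
      List.toFinset_nil, insert_empty_eq]
    rw [@Finset.sum_pair _ _ _ _ (Classical.decEq ι) _ _ (hB.hasDomain hk).1]
    omega

end MarkingNet

/-! ### Matches of subgraphs -/

section Matches

variable {TV TE VQ EQ VH EH : Type*} {TG : DirGraph TV TE} {Q : TypedGraph TG VQ EQ}
  {H : TypedGraph TG VH EH} {A B S S' : Subgraph Q.toDirGraph} {K : Subgraph H.toDirGraph}
  {m m' : PMap VQ EQ VH EH} {v : VQ} {e : EQ} {y : EH}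

theorem PMap.HasDomain.restrict_eq (hm : m.HasDomain S) : m.restrict S = m := by
  refine Prod.ext (funext fun v => ?_) (funext fun e => ?_)
  · have hdom := hm.1 v
    by_cases hv : v ∈ S.verts <;> simp_all [restrict]
  · have hdom := hm.2 e
    by_cases he : e ∈ S.edges <;> simp_all [restrict]

theorem allMatches.hasDomain (hm : m ∈ allMatches Q H S K) : m.HasDomain S := ⟨hm.1, hm.2.1⟩

theorem allMatches_subset_top (S : Subgraph Q.toDirGraph) (K : Subgraph H.toDirGraph) :
    allMatches Q H S K ⊆ allMatches Q H S ⊤ := fun _ ⟨hverts, hedges, hv, he⟩ =>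
  ⟨hverts, hedges, fun v x hx => ⟨trivial, (hv v x hx).2⟩, fun e y hy => ⟨trivial, (he e y hy).2⟩⟩

theorem restrict_mem_allMatches (hverts : S'.verts ⊆ S.verts) (hedges : S'.edges ⊆ S.edges)
    (hm : m ∈ allMatches Q H S K) : m.restrict S' ∈ allMatches Q H S' K := by
  have hv_of {v x} (h : (m.restrict S').1 v = some x) : m.1 v = some x := by
    by_cases hv : v ∈ S'.verts <;> simp_all [PMap.restrict]
  have he_of {e y} (h : (m.restrict S').2 e = some y) : e ∈ S'.edges ∧ m.2 e = some y := by
    by_cases he : e ∈ S'.edges <;> simp_all [PMap.restrict]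
  obtain ⟨hdomv, hdome, hv, he⟩ := hm
  refine ⟨fun v => ?_, fun e => ?_, fun v x hx => hv v x (hv_of hx), fun e y hy => ?_⟩
  · by_cases h : v ∈ S'.verts
    · simp [PMap.restrict, h, (hdomv v).2 (hverts h)]
    · simp [PMap.restrict, h]
  · by_cases h : e ∈ S'.edges
    · simp [PMap.restrict, h, (hdome e).2 (hedges h)]
    · simp [PMap.restrict, h]
  · obtain ⟨hmem, hy⟩ := he_of hy
    simpa [PMap.restrict, S'.src_mem e hmem, S'.tgt_mem e hmem] using he e y hy

theorem PMap.HasDomain.union (hm : m.HasDomain A) (hm' : m'.HasDomain B) :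
    (m.union m').HasDomain (A ⊔ B) := by
  refine ⟨fun v => ?_, fun e => ?_⟩
  · change _ ↔ v ∈ A.verts ∪ B.verts
    rw [Set.mem_union, ← hm.1, ← hm'.1]
    cases h : m.1 v <;> simp [PMap.union, h]
  · change _ ↔ e ∈ A.edges ∪ B.edges
    rw [Set.mem_union, ← hm.2, ← hm'.2]
    cases h : m.2 e <;> simp [PMap.union, h]

theorem union_mem_allMatches (hm : m ∈ allMatches Q H A K) (hm' : m' ∈ allMatches Q H B K)
    (hcomp : m.restrict (A ⊓ B) = m'.restrict (A ⊓ B)) :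
    m.union m' ∈ allMatches Q H (A ⊔ B) K := by
  have hdom := (allMatches.hasDomain hm).union (allMatches.hasDomain hm')
  have hleft {m m' : PMap VQ EQ VH EH} {v x} (h : m.1 v = some x) :
      (m.union m').1 v = some x := by simp [PMap.union, h]
  have hright {v x} (h : m'.1 v = some x) : (m.union m').1 v = some x := by
    rw [PMap.union_comm (allMatches.hasDomain hm) (allMatches.hasDomain hm') hcomp]
    exact hleft h
  refine ⟨hdom.1, hdom.2, fun v x hx => ?_, fun e y hy => ?_⟩
  · have hx : (m.1 v <|> m'.1 v) = some x := hx
    rw [Option.orElse_eq_orElse, Option.orElse_eq_or, Option.or_eq_some_iff] at hx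
    exact hx.elim (hm.2.2.1 v x) fun h => hm'.2.2.1 v x h.2
  · have hy : (m.2 e <|> m'.2 e) = some y := hy
    rw [Option.orElse_eq_orElse, Option.orElse_eq_or, Option.or_eq_some_iff] at hy
    rcases hy with hy | ⟨-, hy⟩
    · obtain ⟨hK, htype, hsrc, htgt⟩ := hm.2.2.2 e y hy
      exact ⟨hK, htype, hleft hsrc, hleft htgt⟩
    · obtain ⟨hK, htype, hsrc, htgt⟩ := hm'.2.2.2 e y hy
      exact ⟨hK, htype, hright hsrc, hright htgt⟩

theorem ncard_allMatches_ofVertex_le [Finite VH] (v : VQ) (K : Subgraph H.toDirGraph) :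
    (allMatches Q H (Subgraph.ofVertex Q.toDirGraph v) K).ncard ≤
      {x | H.vtype x = Q.vtype v}.ncard := by
  rw [← Set.ncard_image_of_injective _ (Option.some_injective VH)]
  refine Set.ncard_le_ncard_of_injOn (fun m => m.1 v) (fun m hm => ?_) (fun m hm m' hm' h => ?_)
    (Set.toFinite _)
  · obtain ⟨x, hx⟩ := Option.isSome_iff_exists.1 ((hm.1 v).2 rfl)
    exact ⟨x, (hm.2.2.1 v x hx).2, hx.symm⟩
  · rw [← (allMatches.hasDomain hm).restrict_eq, ← (allMatches.hasDomain hm').restrict_eq,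
      PMap.restrict_eq_restrict_iff]
    exact ⟨fun w hw => Set.mem_singleton_iff.1 hw ▸ h, fun _ he => he.elim⟩

open Classical in
/-- The match of the query edge `e` to the host edge `y`, if the types agree and `e` is no loop. -/
noncomputable def edgeMatch (Q : TypedGraph TG VQ EQ) (H : TypedGraph TG VH EH) (e : EQ) (y : EH) :
    PMap VQ EQ VH EH :=
  (fun v => if v = Q.src e then some (H.src y) else if v = Q.tgt e then some (H.tgt y) else none,
    fun e' => if e' = e then some y else none)

theorem edgeMatch_injective : Function.Injective (edgeMatch Q H e) := fun y y' h => by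
  simpa [edgeMatch] using congrFun (congrArg Prod.snd h) e

theorem edgeMatch_mem_allMatches (he : Q.src e ≠ Q.tgt e) (hy : H.etype y = Q.etype e) :
    edgeMatch Q H e y ∈ allMatches Q H (Subgraph.ofEdge Q.toDirGraph e) ⊤ := by
  refine ⟨fun v => ?_, fun e' => ?_, fun v x hx => ⟨trivial, ?_⟩, fun e' y' hy' => ?_⟩
  · by_cases hsrc : v = Q.src e <;> by_cases htgt : v = Q.tgt e <;>
      simp [edgeMatch, Subgraph.ofEdge, hsrc, htgt, he.symm]
  · by_cases h : e' = e <;> simp [edgeMatch, Subgraph.ofEdge, h]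
  · simp only [edgeMatch] at hx
    split_ifs at hx with hsrc htgt
    · cases hx
      rw [hsrc, H.src_type, Q.src_type, hy]
    · cases hx
      rw [htgt, H.tgt_type, Q.tgt_type, hy]
  · simp only [edgeMatch] at hy'
    split_ifs at hy' with h
    cases hy'
    subst h
    exact ⟨trivial, hy, by simp [edgeMatch], by simp [edgeMatch, he.symm]⟩

theorem ncard_edges_le_ncard_allMatches_ofEdge [Finite VQ] [Finite EQ] [Finite VH] [Finite EH]
    (he : Q.src e ≠ Q.tgt e) :
    {y | H.etype y = Q.etype e}.ncard ≤
      (allMatches Q H (Subgraph.ofEdge Q.toDirGraph e) ⊤).ncard :=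
  Set.ncard_le_ncard_of_injOn (edgeMatch Q H e) (fun _ hy => edgeMatch_mem_allMatches he hy)
    edgeMatch_injective.injOn (Set.toFinite _)

theorem TypedGraph.EdgeDominated.ncard_allMatches_ofVertex_le [Finite VQ] [Finite EQ] [Finite VH]
    [Finite EH] (hH : H.EdgeDominated) (he : Q.src e ≠ Q.tgt e) (x : EdgeEnd) :
    (allMatches Q H (Subgraph.ofVertex Q.toDirGraph (Q.endpoint x e)) ⊤).ncard ≤
      (allMatches Q H (Subgraph.ofEdge Q.toDirGraph e) ⊤).ncard := by
  refine (Rete.ncard_allMatches_ofVertex_le _ _).trans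
    (le_trans ?_ (ncard_edges_le_ncard_allMatches_ofEdge he))
  have hdom := max_le_iff.1 (hH (Q.etype e))
  cases x with
  | source => simpa [DirGraph.endpoint, Q.src_type] using hdom.1
  | target => simpa [DirGraph.endpoint, Q.tgt_type] using hdom.2

end Matches

/-! ### Join trees -/

theorem Subgraph.verts_top {V E : Type*} {G : DirGraph V E} :
    (⊤ : Subgraph G).verts = Set.univ := rfl

theorem Subgraph.edges_top {V E : Type*} {G : DirGraph V E} :
    (⊤ : Subgraph G).edges = Set.univ := rfl

theorem Subgraph.ncard_add_ncard_lt {V E : Type*} [Finite V] [Finite E] {G : DirGraph V E}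
    {A B : Subgraph G} (hverts : A.verts ⊆ B.verts) (hedges : A.edges ⊆ B.edges) (hne : A ≠ B) :
    A.verts.ncard + A.edges.ncard < B.verts.ncard + B.edges.ncard := by
  have hv := Set.ncard_le_ncard hverts (Set.toFinite _)
  have he := Set.ncard_le_ncard hedges (Set.toFinite _)
  by_contra hlt
  have hv' := Set.eq_of_subset_of_ncard_le hverts (by omega) (Set.toFinite _)
  have he' := Set.eq_of_subset_of_ncard_le hedges (by omega) (Set.toFinite _)
  cases A
  cases B
  subst hv' he'
  exact hne rfl

namespace JoinTree

variable {V E : Type*} {t t' l r : JoinTree E} {p : List Bool}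

theorem subtree_nil (t : JoinTree E) : t.subtree [] = some t := by
  cases t <;> rfl

theorem subtree_append (h : t.subtree p = some t') (q : List Bool) :
    t.subtree (p ++ q) = t'.subtree q := by
  induction p generalizing t with
  | nil =>
    rw [subtree_nil, Option.some.injEq] at h
    rw [h, List.nil_append]
  | cons b p ih =>
    cases t with
    | input e => simp [subtree] at h
    | join l r => cases b <;> exact ih h

theorem subtree_child (h : t.subtree p = some (join l r)) (b : Bool) :
    t.subtree (p ++ [b]) = some (if b then r else l) := by
  rw [subtree_append h]
  cases b <;> simp [subtree]

theorem mem_nodes_iff : p ∈ t.nodes ↔ ∃ t', t.subtree p = some t' := by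
  induction t generalizing p with
  | input e => cases p <;> simp [nodes, subtree]
  | join l r ihl ihr =>
    rcases p with _ | ⟨b, p⟩
    · simp [nodes, subtree]
    · cases b <;> simp [nodes, subtree, ihl, ihr]

theorem height_subtree_le (h : t.subtree p = some t') : t'.height ≤ t.height := by
  induction p generalizing t with
  | nil =>
    rw [subtree_nil, Option.some.injEq] at h
    rw [h]
  | cons b p ih =>
    cases t with
    | input e => simp [subtree] at h
    | join l r =>
      cases b
      · exact (ih h).trans ((le_max_left _ _).trans (Nat.le_succ _))
      · exact (ih h).trans ((le_max_right _ _).trans (Nat.le_succ _))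

theorem height_add_three_le [Finite V] [Finite E] {G : DirGraph V E} (ht : t.WellFormed G)
    (hloop : ∀ e ∈ (t.query G).edges, G.src e ≠ G.tgt e) :
    t.height + 3 ≤ (t.query G).verts.ncard + (t.query G).edges.ncard := by
  induction t with
  | input e => simp [height, query, Subgraph.ofEdge, Set.ncard_pair (hloop e rfl)]
  | join l r ihl ihr =>
    obtain ⟨hl, hr, -, hne, hne'⟩ := ht
    have hlt := Subgraph.ncard_add_ncard_lt (A := l.query G) (B := (join l r).query G)
      Set.subset_union_left Set.subset_union_left hne
    have hlt' := Subgraph.ncard_add_ncard_lt (A := r.query G) (B := (join l r).query G)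
      Set.subset_union_right Set.subset_union_right hne'
    have hle := ihl hl fun e he => hloop e (Or.inl he)
    have hle' := ihr hr fun e he => hloop e (Or.inr he)
    simp only [height]
    omega

theorem mem_edges_query {G : DirGraph V E} {e : E} (h : t.subtree p = some (input e)) :
    e ∈ (t.query G).edges := by
  induction p generalizing t with
  | nil =>
    rw [subtree_nil, Option.some.injEq] at h
    rw [h]
    rfl
  | cons b p ih =>
    cases t with
    | input e => simp [subtree] at h
    | join l r =>
      cases b
      · exact Or.inl (ih h)
      · exact Or.inr (ih h)

section Consistent

variable {TV TE VH EH : Type*} {TG : DirGraph TV TE} {Q : TypedGraph TG V E}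
  {H : TypedGraph TG VH EH} {C : List Bool → Set (PMap V E VH EH)}

theorem Consistent.eq_allMatches (hC : t.Consistent Q H C) {e : E}
    (hp : t.subtree p = some (input e)) :
    C p = allMatches Q H (Subgraph.ofEdge Q.toDirGraph e) ⊤ := by
  rw [hC p (mem_nodes_iff.2 ⟨_, hp⟩), results, hp]

theorem Consistent.union_mem (hC : t.Consistent Q H C) (hp : t.subtree p = some (join l r))
    {ml mr : PMap V E VH EH} (hl : ml ∈ C (p ++ [false])) (hr : mr ∈ C (p ++ [true]))
    (hcomp : ml.restrict (l.query Q.toDirGraph ⊓ r.query Q.toDirGraph) =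
      mr.restrict (l.query Q.toDirGraph ⊓ r.query Q.toDirGraph)) : ml.union mr ∈ C p := by
  rw [hC p (mem_nodes_iff.2 ⟨_, hp⟩), results, hp]
  exact ⟨ml, hl, mr, hr, hcomp, rfl⟩

theorem Consistent.subset_allMatches (hC : t.Consistent Q H C) (hp : t.subtree p = some t') :
    C p ⊆ allMatches Q H (t'.query Q.toDirGraph) ⊤ := by
  induction t' generalizing p with
  | input e => exact (hC.eq_allMatches hp).subset
  | join l r ihl ihr =>
    rw [hC p (mem_nodes_iff.2 ⟨_, hp⟩), results, hp]
    rintro m ⟨ml, hl, mr, hr, hcomp, rfl⟩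
    exact union_mem_allMatches (ihl (subtree_child hp false) hl) (ihr (subtree_child hp true) hr)
      hcomp

end Consistent

end JoinTree

/-! ### Bounds for the localized net -/

namespace JoinTree

variable {TV TE V E VH EH : Type*} {TG : DirGraph TV TE}

/-- The nodes of the localized net that belong to the node `p` of the original net. -/
def localStructure (t : JoinTree E) (p : List Bool) : Finset LocalNode :=
  match t.subtree p with
  | some (input _) => navigationStructure p
  | some (join _ _) => joinStructure p
  | none => ∅

/-- Sets of matches that contain the results of the nodes of the localized net: those of the
original net `C` for the nodes that correspond to it, and their restrictions for the request
projection structures. -/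
def localBound (t : JoinTree E) (Q : TypedGraph TG V E) (H : TypedGraph TG VH EH)
    (C : List Bool → Set (PMap V E VH EH)) (req : List Bool → Bool → Request V) (n : LocalNode) :
    Set (PMap V E VH EH) :=
  match t.subtree n.1, n.2 with
  | some (input e), .vertexInput x =>
      allMatches Q H (Subgraph.ofVertex Q.toDirGraph (Q.endpoint x e)) ⊤
  | some (input e), .extension x =>
      allMatches Q H (Subgraph.ofVertex Q.toDirGraph (Q.endpoint x e)) ⊤
  | some (input _), .navigation _ => C n.1
  | some (input _), .union => C n.1
  | some (join _ _), .join => C n.1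
  | some (join _ _), .filter b => C (n.1 ++ [b])
  | some (join _ _), .projection b =>
      (fun m => m.restrict (Subgraph.ofVertex Q.toDirGraph (req n.1 b).vertex)) '' C (n.1 ++ [b])
  | some (join _ _), .assignment b =>
      (fun m => m.restrict (Subgraph.ofVertex Q.toDirGraph (req n.1 b).vertex)) '' C (n.1 ++ [b])
  | _, _ => ∅

/-- The markings that occur in the localization of a join tree of height `h`. -/
def markingValues (h : ℕ) : Set ℕ∞ := insert ⊤ ((↑) '' Set.Iic h)

theorem finite_markingValues (h : ℕ) : (markingValues h).Finite :=
  ((Set.finite_Iic h).image _).insert _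

theorem ncard_markingValues_le (h : ℕ) : (markingValues h).ncard ≤ h + 2 := by
  refine (Set.ncard_insert_le _ _).trans (Nat.succ_le_succ ?_)
  refine (Set.ncard_image_le (Set.finite_Iic h)).trans_eq ?_
  rw [Set.ncard_eq_toFinset_card', Set.toFinset_Iic, Nat.card_Iic]

variable {t t' l r : JoinTree E} {G : DirGraph V E} {Q : TypedGraph TG V E}
  {H : TypedGraph TG VH EH} {Hp : Subgraph H.toDirGraph} {C : List Bool → Set (PMap V E VH EH)}
  {req : List Bool → Bool → Request V} {p : List Bool} {e : E} {x : EdgeEnd} {n d : LocalNode}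

theorem localRoot_fst (p : List Bool) : (t.localRoot p).1 = p := by
  unfold localRoot
  split <;> rfl

theorem ne_localRoot_child (b : Bool) (ρ : Role) : (p, ρ) ≠ t.localRoot (p ++ [b]) := fun h => by
  simpa [localRoot_fst] using congrArg Prod.fst h

theorem localRoot_false_ne_localRoot_true :
    t.localRoot (p ++ [false]) ≠ t.localRoot (p ++ [true]) := fun h => by
  simpa [localRoot_fst] using congrArg Prod.fst h

theorem localBound_localRoot (hp : t.subtree p = some t') :
    t.localBound Q H C req (t.localRoot p) = C p := by
  cases t' <;> simp [localBound, localRoot, hp]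

theorem query_localRoot (hp : t.subtree p = some t') :
    (t.localize G req).query (t.localRoot p) = t'.query G := by
  cases t' <;> simp [localize, localRoot, hp, query]

theorem mem_requestsAt :
    d ∈ t.requestsAt req p x ↔ ∃ q b, d = (q, .assignment b) ∧
      (∃ l r, t.subtree q = some (join l r)) ∧ q ++ (!b) :: (req q b).leaf = p ∧
      (req q b).ending = x := by
  simp only [requestsAt, Finset.mem_image, Finset.mem_filter, Finset.mem_product, Finset.mem_univ,
    and_true, Prod.exists]
  constructor
  · rintro ⟨q, b, ⟨-, h⟩, rfl⟩
    exact ⟨q, b, rfl, h⟩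
  · rintro ⟨q, b, rfl, ⟨l, r, h⟩, h'⟩
    exact ⟨q, b, ⟨mem_nodes_iff.2 ⟨_, h⟩, ⟨l, r, h⟩, h'⟩, rfl⟩

theorem notMem_requestsAt_of_ne_assignment {ρ : Role} (hρ : ∀ b, ρ ≠ .assignment b) :
    (p, ρ) ∉ t.requestsAt req p x := fun h => by
  obtain ⟨q, b, h, -⟩ := mem_requestsAt.1 h
  exact hρ b (congrArg Prod.snd h)

theorem ValidRequests.subtree_eq (hreq : t.ValidRequests G req)
    (hp : t.subtree p = some (join l r)) (b : Bool) :
    ∃ e, t.subtree (p ++ (!b) :: (req p b).leaf) = some (input e) ∧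
      G.endpoint (req p b).ending e = (req p b).vertex := by
  obtain ⟨-, e, he, hend⟩ := hreq p l r hp b
  refine ⟨e, ?_, hend⟩
  rw [← List.singleton_append, ← List.append_assoc, subtree_append (subtree_child hp (!b))]
  cases b <;> exact he

theorem ValidRequests.vertex_mem (hreq : t.ValidRequests G req)
    (hp : t.subtree p = some (join l r)) (b : Bool) :
    (req p b).vertex ∈ ((if b then r else l).query G).verts := by
  have hv := (hreq p l r hp b).1
  cases b
  · exact hv.1
  · exact hv.2

theorem localBound_request_subset (hC : t.Consistent Q H C)
    (hreq : t.ValidRequests Q.toDirGraph req) (hp : t.subtree p = some (input e))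
    (hd : d ∈ t.requestsAt req p x) :
    t.localBound Q H C req d ⊆
      allMatches Q H (Subgraph.ofVertex Q.toDirGraph (Q.endpoint x e)) ⊤ := by
  obtain ⟨q, b, rfl, ⟨l, r, hq⟩, rfl, rfl⟩ := mem_requestsAt.1 hd
  obtain ⟨e', he', hend⟩ := hreq.subtree_eq hq b
  obtain rfl : e' = e := by simpa [hp, eq_comm] using he'
  simp only [localBound, hq]
  rintro _ ⟨m, hm, rfl⟩
  rw [hend]
  exact restrict_mem_allMatches (Set.singleton_subset_iff.2 (hreq.vertex_mem hq b))
    (Set.empty_subset _) (hC.subset_allMatches (subtree_child hq b) hm)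

theorem notMem_deps_localize (n : LocalNode) : n ∉ (t.localize G req).deps n := by
  obtain ⟨p, ρ⟩ := n
  rcases hp : t.subtree p with _ | _ | _
  · cases ρ <;> simp [MarkingNet.deps, localize, hp]
  · cases ρ <;> simp [MarkingNet.deps, localize, hp, notMem_requestsAt_of_ne_assignment]
  · cases ρ <;> simp [MarkingNet.deps, localize, hp, ne_localRoot_child]

theorem closedAt_localize_of_input (hC : t.Consistent Q H C)
    (hreq : t.ValidRequests Q.toDirGraph req) (hp : t.subtree p = some (input e)) (ρ : Role) :
    (t.localize Q.toDirGraph req).ClosedAt H Hp (t.localBound Q H C req) (markingValues t.height)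
      (p, ρ) := by
  cases ρ with
  | vertexInput x =>
    simp only [MarkingNet.ClosedAt, localize, localBound, hp]
    exact ⟨allMatches_subset_top _ _, Set.mem_insert _ _⟩
  | extension x =>
    simp only [MarkingNet.ClosedAt, localize, hp, Finset.forall_mem_insert]
    refine ⟨by simp [localBound, hp], fun d hd => ?_⟩
    refine (localBound_request_subset hC hreq hp hd).trans ?_
    simp [localBound, hp]
  | navigation x =>
    simp only [MarkingNet.ClosedAt, localize, localBound, hp]
    exact (hC.eq_allMatches hp).superset
  | _ => simp [MarkingNet.ClosedAt, localize, localBound, hp]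

theorem closedAt_localize_of_join (hC : t.Consistent Q H C) (hp : t.subtree p = some (join l r))
    (ρ : Role) :
    (t.localize Q.toDirGraph req).ClosedAt H Hp (t.localBound Q H C req) (markingValues t.height)
      (p, ρ) := by
  cases ρ with
  | join =>
    have hl : t.subtree (p ++ [false]) = some l := subtree_child hp false
    have hr : t.subtree (p ++ [true]) = some r := subtree_child hp true
    have hk : (t.localize Q.toDirGraph req).kind (p, .join) =
        .join (t.localRoot (p ++ [false])) (t.localRoot (p ++ [true])) := by simp [localize, hp]
    have hbound : t.localBound Q H C req (p, .join) = C p := by simp [localBound, hp]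
    simp only [MarkingNet.ClosedAt, hk, query_localRoot hl, query_localRoot hr,
      localBound_localRoot hl, localBound_localRoot hr, hbound]
    exact ⟨localRoot_false_ne_localRoot_true,
      fun m hm => allMatches.hasDomain (hC.subset_allMatches hl hm),
      fun m hm => allMatches.hasDomain (hC.subset_allMatches hr hm),
      fun ml hml mr hmr hcomp => hC.union_mem hp hml hmr hcomp⟩
  | filter b =>
    simp only [MarkingNet.ClosedAt, localize, hp, localBound_localRoot (subtree_child hp b)]
    simp [localBound, hp]
  | projection b =>
    simp only [MarkingNet.ClosedAt, localize, localBound, hp]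
    exact fun m hm => ⟨m, hm, rfl⟩
  | assignment b =>
    simp only [MarkingNet.ClosedAt, localize, localBound, hp]
    exact ⟨subset_rfl, Or.inr ⟨_, height_subtree_le hp, rfl⟩⟩
  | _ => simp [MarkingNet.ClosedAt, localize, hp]

theorem localize_bounds (hC : t.Consistent Q H C) (hreq : t.ValidRequests Q.toDirGraph req) :
    (t.localize Q.toDirGraph req).Bounds H Hp (t.localBound Q H C req)
      (markingValues t.height) := by
  refine ⟨notMem_deps_localize, fun ⟨p, ρ⟩ => ?_⟩
  rcases hp : t.subtree p with _ | e | ⟨l, r⟩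
  · simp [MarkingNet.ClosedAt, localize, hp]
  · exact closedAt_localize_of_input hC hreq hp ρ
  · exact closedAt_localize_of_join hC hp ρ

theorem mem_nodes_localize_iff :
    n ∈ (t.localize G req).nodes ↔ ∃ p ∈ t.nodes, n ∈ t.localStructure p :=
  Finset.mem_biUnion

theorem mem_nodes_of_mem_order {sort : List Bool → List LocalNode}
    (hsort : ∀ p e, t.subtree p = some (input e) →
      (t.localize G req).IsReverseToposort (navigationStructure p) (sort p))
    (hp : t.subtree p = some t') (hn : n ∈ t'.order sort p) : n ∈ (t.localize G req).nodes := by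
  have own (p : List Bool) (t' : JoinTree E) (hp : t.subtree p = some t')
      (hn : n ∈ t.localStructure p) : n ∈ (t.localize G req).nodes :=
    mem_nodes_localize_iff.2 ⟨p, mem_nodes_iff.2 ⟨t', hp⟩, hn⟩
  induction t' generalizing p with
  | input e => exact own p _ hp (by simpa [localStructure, hp] using ((hsort p e hp).2.1 n).1 hn)
  | join l r ihl ihr =>
    have hrequest (b : Bool) (h : n ∈ requestOrder p b) : n ∈ t.localStructure p := by
      cases b <;> simp only [requestOrder, List.mem_cons, List.not_mem_nil, or_false] at h <;>
        rcases h with rfl | rfl | rfl <;> simp [localStructure, hp, joinStructure]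
    simp only [order, List.mem_append, List.mem_singleton] at hn
    rcases hn with (((((h | h) | h) | h) | h) | h) | rfl
    · exact own p _ hp (hrequest true h)
    · exact ihl (subtree_child hp false) h
    · exact own p _ hp (hrequest false h)
    · exact ihr (subtree_child hp true) h
    · exact own p _ hp (hrequest true h)
    · exact ihl (subtree_child hp false) h
    · exact own p _ hp (by simp [localStructure, hp, joinStructure])

end JoinTree

/-! ### The total charge of the localized net -/

section Weight

variable {TV TE VQ EQ VH EH : Type*} [Finite VQ] [Finite EQ] [Finite VH] [Finite EH]
  {TG : DirGraph TV TE} {Q : TypedGraph TG VQ EQ} {H : TypedGraph TG VH EH} {e : EQ}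

theorem matchSum_image_le {α β : Type*} [Finite α] [Finite β] (r : α → β) (S : Set α)
    (f : β → ℕ) : matchSum (r '' S) f ≤ matchSum S fun m => f (r m) := by
  refine le_trans (matchSum_mono subset_rfl ?_)
    (matchSum_fiber_le (r '' S) S r fun m => f (r m))
  rintro _ ⟨m, hm, rfl⟩
  exact Finset.single_le_sum (f := fun m => f (r m)) (fun _ _ => Nat.zero_le _) (by simpa using hm)

theorem weight_image_restrict_le {G : DirGraph VQ EQ} (q : ℕ) (S : Subgraph G)
    (A : Set (PMap VQ EQ VH EH)) : weight q ((fun m => m.restrict S) '' A) ≤ weight q A :=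
  (matchSum_image_le _ A _).trans
    (matchSum_mono subset_rfl fun m _ => Nat.add_le_add_right (m.size_restrict_le S) q)

theorem weight_eq (q : ℕ) (A : Set (PMap VQ EQ VH EH)) :
    weight q A = (∑ᶠ m ∈ A, m.size) + A.ncard * q := by
  rw [weight, matchSum_add, matchSum_const, finsum_mem_eq_finite_toFinset_sum _ A.toFinite]
  rfl

theorem weight_allMatches (q : ℕ) (S : Subgraph Q.toDirGraph) (K : Subgraph H.toDirGraph) :
    weight q (allMatches Q H S K) =
      (allMatches Q H S K).ncard * (S.verts.ncard + S.edges.ncard + q) := by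
  rw [← matchSum_const, weight]
  exact Finset.sum_congr rfl fun m hm => by
    simp only [(allMatches.hasDomain ((Set.Finite.mem_toFinset _).1 hm)).size_eq]

theorem TypedGraph.EdgeDominated.weight_allMatches_ofVertex_le (hH : H.EdgeDominated)
    (he : Q.src e ≠ Q.tgt e) (q : ℕ) (x : EdgeEnd) :
    weight q (allMatches Q H (Subgraph.ofVertex Q.toDirGraph (Q.endpoint x e)) ⊤) ≤
      weight q (allMatches Q H (Subgraph.ofEdge Q.toDirGraph e) ⊤) := by
  rw [weight_allMatches, weight_allMatches]
  refine Nat.mul_le_mul (hH.ncard_allMatches_ofVertex_le he x) ?_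
  simp [Subgraph.ofVertex, Subgraph.ofEdge]

end Weight

namespace JoinTree

section Sums

variable {V E : Type*} {t l r : JoinTree E} {G : DirGraph V E} {req : List Bool → Bool → Request V}
  {p : List Bool} {n : LocalNode}

theorem fst_eq_of_mem_localStructure (hn : n ∈ t.localStructure p) : n.1 = p := by
  unfold localStructure navigationStructure joinStructure at hn
  split at hn <;> aesop

theorem sum_nodes_localize (f : LocalNode → ℕ) :
    ∑ n ∈ (t.localize G req).nodes, f n = ∑ p ∈ t.nodes, ∑ n ∈ t.localStructure p, f n :=
  Finset.sum_biUnion fun _ _ _ _ hne => Finset.disjoint_left.2 fun _ h h' =>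
    hne ((fst_eq_of_mem_localStructure h).symm.trans (fst_eq_of_mem_localStructure h'))

open Classical in
/-- The pairs of a join and one of its two dependencies. They index both the nodes other than the
root and the request projection structures. -/
noncomputable def joinChildren (t : JoinTree E) : Finset (List Bool × Bool) :=
  (t.nodes ×ˢ (Finset.univ : Finset Bool)).filter fun a => ∃ l r, t.subtree a.1 = some (join l r)

/-- The extension point to which a request projection structure is connected: a leaf and an end of
the edge there. -/
def requestTarget (req : List Bool → Bool → Request V) (a : List Bool × Bool) :
    List Bool × EdgeEnd :=
  (a.1 ++ (!a.2) :: (req a.1 a.2).leaf, (req a.1 a.2).ending)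

theorem mem_joinChildren {a : List Bool × Bool} :
    a ∈ t.joinChildren ↔ ∃ l r, t.subtree a.1 = some (join l r) := by
  simp only [joinChildren, Finset.mem_filter, Finset.mem_product, Finset.mem_univ, and_true,
    and_iff_right_iff_imp]
  rintro ⟨l, r, h⟩
  exact mem_nodes_iff.2 ⟨_, h⟩

theorem sum_joinChildren_le (f : List Bool → ℕ) :
    ∑ a ∈ t.joinChildren, f (a.1 ++ [a.2]) ≤ ∑ p ∈ t.nodes, f p := by
  classical
  rw [← Finset.sum_image (f := f) (g := fun a : List Bool × Bool => a.1 ++ [a.2])]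
  · refine Finset.sum_le_sum_of_subset fun p hp => ?_
    obtain ⟨a, ha, rfl⟩ := Finset.mem_image.1 hp
    obtain ⟨l, r, h⟩ := mem_joinChildren.1 ha
    exact mem_nodes_iff.2 ⟨_, subtree_child h a.2⟩
  · rintro ⟨p, b⟩ _ ⟨p', b'⟩ _ h
    obtain ⟨hp, hb⟩ := List.append_inj' h rfl
    exact Prod.ext hp (List.singleton_injective hb)

theorem sum_joinChildren_fst_eq (f : List Bool × Bool → ℕ) (hp : t.subtree p = some (join l r)) :
    ∑ a ∈ t.joinChildren with a.1 = p, f a = f (p, false) + f (p, true) := by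
  have hfilter : {a ∈ t.joinChildren | a.1 = p} = {(p, false), (p, true)} := by
    ext ⟨p', b⟩
    simp only [Finset.mem_filter, mem_joinChildren, Finset.mem_insert, Finset.mem_singleton,
      Prod.mk.injEq]
    cases b <;> aesop
  rw [hfilter, Finset.sum_pair (by simp)]

theorem sum_nodes_joinChildren (f : List Bool × Bool → ℕ) :
    ∑ p ∈ t.nodes, ∑ a ∈ t.joinChildren with a.1 = p, f a = ∑ a ∈ t.joinChildren, f a :=
  Finset.sum_fiberwise_of_maps_to (fun a ha => by
    obtain ⟨l, r, h⟩ := mem_joinChildren.1 ha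
    exact mem_nodes_iff.2 ⟨_, h⟩) f

theorem sum_requestsAt (f : LocalNode → ℕ) (p : List Bool) (x : EdgeEnd) :
    ∑ d ∈ t.requestsAt req p x, f d =
      ∑ a ∈ t.joinChildren with requestTarget req a = (p, x), f (a.1, .assignment a.2) := by
  classical
  have himage : t.requestsAt req p x = {a ∈ t.joinChildren | requestTarget req a = (p, x)}.image
      fun a => (a.1, Role.assignment a.2) := by
    ext d
    simp only [mem_requestsAt, requestTarget, Finset.mem_image, Finset.mem_filter,
      mem_joinChildren, Prod.mk.injEq, Prod.exists]
    exact exists₂_congr fun q b => ⟨fun ⟨h, h'⟩ => ⟨h', h.symm⟩, fun ⟨h, h'⟩ => ⟨h'.symm, h⟩⟩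
  rw [himage, Finset.sum_image]
  rintro ⟨q, b⟩ _ ⟨q', b'⟩ _ h
  simpa using h

theorem sum_nodes_requestsAt_le (f : LocalNode → ℕ) :
    ∑ p ∈ t.nodes, (∑ d ∈ t.requestsAt req p .source, f d + ∑ d ∈ t.requestsAt req p .target, f d) ≤
      ∑ a ∈ t.joinChildren, f (a.1, .assignment a.2) := by
  let g (p : List Bool) (x : EdgeEnd) : ℕ :=
    ∑ a ∈ t.joinChildren with requestTarget req a = (p, x), f (a.1, .assignment a.2)
  have hpair (p : List Bool) :
      ∑ d ∈ t.requestsAt req p .source, f d + ∑ d ∈ t.requestsAt req p .target, f d =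
        ∑ x ∈ {.source, .target}, g p x := by
    rw [Finset.sum_pair (by simp), sum_requestsAt, sum_requestsAt]
  simp only [hpair]
  rw [← Finset.sum_product']
  exact (Finset.sum_fiberwise_eq_sum_filter _ _ (requestTarget req) _).trans_le
    (Finset.sum_le_sum_of_subset (Finset.filter_subset _ _))

end Sums

section Charge

variable {TV TE V E VH EH : Type*} {TG : DirGraph TV TE} {t l r : JoinTree E} [Finite V] [Finite E]
  [Finite VH] [Finite EH] {Q : TypedGraph TG V E} {H : TypedGraph TG VH EH}
  {C : List Bool → Set (PMap V E VH EH)} {req : List Bool → Bool → Request V} {p : List Bool}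
  {e : E}

theorem weight_localBound_assignment_le (q : ℕ) (hp : t.subtree p = some (join l r)) (b : Bool) :
    weight q (t.localBound Q H C req (p, .assignment b)) ≤ weight q (C (p ++ [b])) := by
  simp only [localBound, hp]
  exact weight_image_restrict_le q _ _

theorem chargeBound_extension_le (q : ℕ) (hp : t.subtree p = some (input e)) (x : EdgeEnd)
    (hv : weight q (allMatches Q H (Subgraph.ofVertex Q.toDirGraph (Q.endpoint x e)) ⊤) ≤
      weight q (C p)) :
    (t.localize Q.toDirGraph req).chargeBound (t.localBound Q H C req) q (p, .extension x) ≤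
      5 * weight q (C p) +
        5 * ∑ d ∈ t.requestsAt req p x, weight q (t.localBound Q H C req d) := by
  have hbound : t.localBound Q H C req (p, .vertexInput x) =
      allMatches Q H (Subgraph.ofVertex Q.toDirGraph (Q.endpoint x e)) ⊤ := by
    simp [localBound, hp]
  simp only [MarkingNet.chargeBound, localize, hp]
  rw [Finset.sum_insert (notMem_requestsAt_of_ne_assignment (by simp)), ← Finset.mul_sum, hbound]
  exact Nat.add_le_add_right (Nat.mul_le_mul_left 5 hv) _

theorem sum_chargeBound_navigationStructure_le (hH : H.EdgeDominated) (hC : t.Consistent Q H C)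
    (q : ℕ) (hp : t.subtree p = some (input e)) (he : Q.src e ≠ Q.tgt e) :
    ∑ n ∈ navigationStructure p,
        (t.localize Q.toDirGraph req).chargeBound (t.localBound Q H C req) q n ≤
      32 * weight q (C p) + 5 *
        (∑ d ∈ t.requestsAt req p .source, weight q (t.localBound Q H C req d) +
          ∑ d ∈ t.requestsAt req p .target, weight q (t.localBound Q H C req d)) := by
  have hv (x : EdgeEnd) : weight q (allMatches Q H (Subgraph.ofVertex Q.toDirGraph
      (Q.endpoint x e)) ⊤) ≤ weight q (C p) := by
    rw [hC.eq_allMatches hp]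
    exact hH.weight_allMatches_ofVertex_le he q x
  have hinput (x : EdgeEnd) : (t.localize Q.toDirGraph req).chargeBound (t.localBound Q H C req) q
      (p, .vertexInput x) ≤ weight q (C p) := by
    simpa [MarkingNet.chargeBound, localize, localBound, hp] using hv x
  have hextension (x : EdgeEnd) := chargeBound_extension_le (req := req) q hp x (hv x)
  have hnavigation (x : EdgeEnd) : (t.localize Q.toDirGraph req).chargeBound
      (t.localBound Q H C req) q (p, .navigation x) ≤ 5 * weight q (C p) := by
    simp only [MarkingNet.chargeBound, localize, localBound, hp]
    have := hv x
    omega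
  have hunion : (t.localize Q.toDirGraph req).chargeBound (t.localBound Q H C req) q
      (p, .union) = 10 * weight q (C p) := by
    simp only [MarkingNet.chargeBound, localize, hp]
    rw [Finset.sum_pair (by simp)]
    simp only [localBound, hp]
    omega
  simp only [navigationStructure, Finset.sum_insert, Finset.sum_singleton, Finset.mem_insert,
    Finset.mem_singleton, Prod.mk.injEq, true_and, reduceCtorEq, Role.vertexInput.injEq,
    Role.extension.injEq, Role.navigation.injEq, or_self, not_false_eq_true, hunion]
  linarith [hinput .source, hinput .target, hextension .source, hextension .target,
    hnavigation .source, hnavigation .target]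

theorem sum_chargeBound_joinStructure_le (q : ℕ) (hp : t.subtree p = some (join l r)) :
    ∑ n ∈ joinStructure p,
        (t.localize Q.toDirGraph req).chargeBound (t.localBound Q H C req) q n ≤
      4 * weight q (C p) + 18 * (weight q (C (p ++ [false])) + weight q (C (p ++ [true]))) := by
  have hjoin : (t.localize Q.toDirGraph req).chargeBound (t.localBound Q H C req) q (p, .join) =
      3 * weight q (C (p ++ [false])) + 3 * weight q (C (p ++ [true])) + 4 * weight q (C p) := by
    simp only [MarkingNet.chargeBound, localize, hp, localBound_localRoot (subtree_child hp _)]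
    simp only [localBound, hp]
  have hfilter (b : Bool) : (t.localize Q.toDirGraph req).chargeBound (t.localBound Q H C req) q
      (p, .filter b) = 5 * weight q (C (p ++ [b])) := by
    simp only [MarkingNet.chargeBound, localize, hp, localBound_localRoot (subtree_child hp b)]
  have hprojection (b : Bool) : (t.localize Q.toDirGraph req).chargeBound
      (t.localBound Q H C req) q (p, .projection b) = 5 * weight q (C (p ++ [b])) := by
    simp only [MarkingNet.chargeBound, localize, localBound, hp]
  have hassignment (b : Bool) : (t.localize Q.toDirGraph req).chargeBound
      (t.localBound Q H C req) q (p, .assignment b) ≤ 5 * weight q (C (p ++ [b])) := by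
    have := weight_localBound_assignment_le (Q := Q) (H := H) (C := C) (req := req) q hp b
    simp only [MarkingNet.chargeBound, localize, localBound, hp] at this ⊢
    omega
  simp only [joinStructure, Finset.sum_insert, Finset.sum_singleton, Finset.mem_insert,
    Finset.mem_singleton, Prod.mk.injEq, true_and, reduceCtorEq, Role.filter.injEq,
    Role.projection.injEq, Role.assignment.injEq, Bool.false_eq_true, or_self, not_false_eq_true,
    hjoin, hfilter, hprojection]
  linarith [hassignment false, hassignment true]

theorem sum_chargeBound_localStructure_le (hH : H.EdgeDominated) (hC : t.Consistent Q H C)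
    (hloop : ∀ e ∈ (t.query Q.toDirGraph).edges, Q.src e ≠ Q.tgt e) (q : ℕ) (p : List Bool) :
    ∑ n ∈ t.localStructure p,
        (t.localize Q.toDirGraph req).chargeBound (t.localBound Q H C req) q n ≤
      32 * weight q (C p) +
      5 * (∑ d ∈ t.requestsAt req p .source, weight q (t.localBound Q H C req d) +
        ∑ d ∈ t.requestsAt req p .target, weight q (t.localBound Q H C req d)) +
      18 * ∑ a ∈ t.joinChildren with a.1 = p, weight q (C (a.1 ++ [a.2])) := by
  rcases hp : t.subtree p with _ | e | ⟨l, r⟩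
  · simp [localStructure, hp]
  · have hle := sum_chargeBound_navigationStructure_le (req := req) hH hC q hp
      (hloop e (mem_edges_query hp))
    simp only [localStructure, hp]
    exact hle.trans (Nat.le_add_right _ _)
  · have hle := sum_chargeBound_joinStructure_le (Q := Q) (H := H) (C := C) (req := req) q hp
    rw [sum_joinChildren_fst_eq _ hp]
    simp only [localStructure, hp]
    omega

theorem sum_chargeBound_le (hH : H.EdgeDominated) (hC : t.Consistent Q H C)
    (hloop : ∀ e ∈ (t.query Q.toDirGraph).edges, Q.src e ≠ Q.tgt e) (q : ℕ) :
    ∑ n ∈ (t.localize Q.toDirGraph req).nodes,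
        (t.localize Q.toDirGraph req).chargeBound (t.localBound Q H C req) q n ≤
      55 * ∑ p ∈ t.nodes, weight q (C p) := by
  have hchildren := sum_joinChildren_le (t := t) fun p => weight q (C p)
  have hrequests : ∑ a ∈ t.joinChildren, weight q (t.localBound Q H C req (a.1, .assignment a.2)) ≤
      ∑ a ∈ t.joinChildren, weight q (C (a.1 ++ [a.2])) := Finset.sum_le_sum fun a ha => by
    obtain ⟨l, r, h⟩ := mem_joinChildren.1 ha
    exact weight_localBound_assignment_le q h a.2
  have hconnected := sum_nodes_requestsAt_le (t := t) (req := req) fun d =>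
    weight q (t.localBound Q H C req d)
  rw [sum_nodes_localize]
  refine (Finset.sum_le_sum fun p _ =>
    sum_chargeBound_localStructure_le hH hC hloop q p).trans ?_
  rw [Finset.sum_add_distrib, Finset.sum_add_distrib, ← Finset.mul_sum, ← Finset.mul_sum,
    ← Finset.mul_sum, sum_nodes_joinChildren]
  omega

theorem sum_weight_eq (t : JoinTree E) (C : List Bool → Set (PMap V E VH EH)) (q : ℕ) :
    ((∑ p ∈ t.nodes, weight q (C p) : ℕ) : ℝ) =
      t.totalMatches C * (t.averageMatchSize C + (q : ℝ)) := by
  have hsum : ∑ p ∈ t.nodes, weight q (C p) =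
      (∑ p ∈ t.nodes, ∑ᶠ m ∈ C p, m.size) + t.totalMatches C * q := by
    simp only [weight_eq, Finset.sum_add_distrib, totalMatches, Finset.sum_mul]
  rw [hsum, averageMatchSize]
  by_cases hT : t.totalMatches C = 0
  · have hsize : ∑ p ∈ t.nodes, ∑ᶠ m ∈ C p, m.size = 0 := Finset.sum_eq_zero fun p hp => by
      have hcard : (C p).ncard = 0 := Finset.sum_eq_zero_iff.1 hT p hp
      rw [(Set.ncard_eq_zero (Set.toFinite _)).1 hcard]
      exact finsum_mem_empty
    simp [hT, hsize]
  · have hT : (t.totalMatches C : ℝ) ≠ 0 := Nat.cast_ne_zero.2 hT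
    push_cast
    field_simp

end Charge

end JoinTree

end Rete

open Rete in
theorem theorem4_general {TV TE VQ EQ VH EH : Type*} [Finite VQ] [Finite EQ] [Finite VH]
    [Finite EH] {TG : DirGraph TV TE} {Q : TypedGraph TG VQ EQ} {H : TypedGraph TG VH EH}
    (Hp : Subgraph H.toDirGraph) {t : JoinTree EQ} {C : List Bool → Set (PMap VQ EQ VH EH)}
    {req : List Bool → Bool → Request VQ} {O : List LocalNode}
    (hloop : ∀ e ∈ (t.query Q.toDirGraph).edges, Q.src e ≠ Q.tgt e) (hH : H.EdgeDominated)
    (ht : t.WellFormed Q.toDirGraph) (hC : t.Consistent Q H C)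
    (hreq : t.ValidRequests Q.toDirGraph req)
    (hO : ∀ n ∈ O, n ∈ (t.localize Q.toDirGraph req).nodes) :
    ((t.localize Q.toDirGraph req).run H Hp O).config =
        (t.localize Q.toDirGraph req).execute H Hp O (fun _ => ∅) ∧
      (((t.localize Q.toDirGraph req).run H Hp O).steps : ℝ) ≤
        55 * (t.totalMatches C * (t.averageMatchSize C +
          ((t.query Q.toDirGraph).verts.ncard + (t.query Q.toDirGraph).edges.ncard : ℕ))) := by
  obtain ⟨hs, hconfig, hsteps⟩ :=
    MarkingNet.run_spec (JoinTree.localize_bounds (Hp := Hp) hC hreq) hO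
  have hheight := JoinTree.height_add_three_le ht hloop
  have hmarkings := JoinTree.ncard_markingValues_le t.height
  refine ⟨hconfig, ?_⟩
  rw [← JoinTree.sum_weight_eq]
  exact_mod_cast calc
    _ ≤ _ := hsteps
    _ ≤ _ := Finset.sum_le_sum fun n _ => hs.nodeCharge_le (JoinTree.localize_bounds hC hreq)
      (JoinTree.finite_markingValues _) (by omega) (by omega) n
    _ ≤ _ := JoinTree.sum_chargeBound_le hH hC hloop _

open Rete in
theorem theorem4 :
    ∃ K : ℝ, ∀ {TV : Type u₁} {TE : Type u₂} {VQ : Type u₃} {EQ : Type u₄} {VH : Type u₅}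
      {EH : Type u₆} [Finite VQ] [Finite EQ] [Finite VH] [Finite EH] {TG : DirGraph TV TE}
      (Q : TypedGraph TG VQ EQ) (H : TypedGraph TG VH EH) (Hp : Subgraph H.toDirGraph)
      (t : JoinTree EQ) (C : List Bool → Set (PMap VQ EQ VH EH))
      (req : List Bool → Bool → Request VQ) (sort : List Bool → List LocalNode),
      (∀ e, Q.src e ≠ Q.tgt e) →
      H.EdgeDominated →
      t.WellFormed Q.toDirGraph →
      t.query Q.toDirGraph = ⊤ →
      t.Consistent Q H C →
      t.ValidRequests Q.toDirGraph req →
      (∀ p e, t.subtree p = some (JoinTree.input e) →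
        (t.localize Q.toDirGraph req).IsReverseToposort
          (JoinTree.navigationStructure p) (sort p)) →
      ((t.localize Q.toDirGraph req).run H Hp (t.order sort [])).config
          = (t.localize Q.toDirGraph req).execute H Hp (t.order sort []) (fun _ => ∅) ∧
      (((t.localize Q.toDirGraph req).run H Hp (t.order sort [])).steps : ℝ)
          ≤ K * (t.totalMatches C *
              (t.averageMatchSize C + ((Nat.card VQ + Nat.card EQ : ℕ) : ℝ))) := by
  refine ⟨55, fun Q H Hp t C req sort hloop hH ht htop hC hreq hsort => ?_⟩
  have hspec := theorem4_general Hp (fun e _ => hloop e) hH ht hC hreq fun _ =>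
    JoinTree.mem_nodes_of_mem_order hsort t.subtree_nil
  rwa [htop, Subgraph.verts_top, Subgraph.edges_top, Set.ncard_univ, Set.ncard_univ] at hspec
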